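/- Let $\mathcal R$ be a Poisson process of intensity $1$ on $\mathbb R$, defined on a probability space $(\Omega,\mathbb P)$, and write $[\mathcal R]$ for its set of points. A one-color matching scheme of $\mathcal R$ is a simple point process $\mathcal M$ of unordered pairs of reals, on the same probability space, whose set $[\mathcal M]$ of pairs is almost surely the edge set of a perfect matching of $[\mathcal R]$ (a simple graph on $[\mathcal R]$ with all degrees $1$); $\mathcal M(x)$ denotes the partner of $x\in[\mathcal R]$. The scheme is translation-invariant (isometry-invariant) if the joint law of $(\mathcal R,\mathcal M)$ is invariant under all translations (all isometries) of $\mathbb R$. It is a factor if almost surely $\mathcal M=f(\mathcal R)$ for some deterministic measurable function $f$, and randomized if it is not a factor. For a translation-invariant scheme, the typical matching distance $X$ is the random variable, with probability measure $\mathbb P^*$ and expectation $\mathbb E^*$, whose distribution function is $$\mathbb P^*(X\le r)=\mathbb E\,\#\{x\in[\mathcal R]\cap[0,1): |x-\mathcal M(x)|\le r\}.$$ Then: (i) for every translation-invariant factor one-color matching scheme $\mathcal M$ of $\mathcal R$, the random variable $X$ is well defined (the right-hand side above is the distribution function of a probability measure on $\mathbb R$), and $\mathbb E^*X=\infty$;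 (ii) after extending the probability space if necessary, there exists an isometry-invariant randomized one-color matching scheme of $\mathcal R$ for which $X$ is well defined and $\mathbb P^*(X>r)=e^{-r}$ for all $r>0$. -/

import Mathlib

open MeasureTheory ProbabilityTheory
open scoped ENNReal NNReal

namespace PoissonMatching

/-- A locally finite counting measure without multiple points: a sum of unit masses at the points
of a countable set, finite near every point. -/
def IsSimpleCounting {E : Type*} [TopologicalSpace E] [MeasurableSpace E] (μ : Measure E) : Prop :=
  IsLocallyFiniteMeasure μ ∧
    ∃ S : Set E, S.Countable ∧ μ = Measure.sum (fun x : S => Measure.dirac (x : E))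

/-- The support `[μ]` of a simple counting measure: the set of its points. -/
def supp {E : Type*} [MeasurableSpace E] (μ : Measure E) : Set E :=
  {x | μ {x} = 1}

/-- A simple point process in `E`, defined on the probability space `(Ω, P)`. The space of measures
carries the sigma-algebra generated by the evaluations at measurable sets. -/
structure IsSimplePointProcess {Ω E : Type*} [MeasurableSpace Ω] [TopologicalSpace E]
    [MeasurableSpace E] (P : Measure Ω) (N : Ω → Measure E) : Prop where
  measurable : Measurable N
  simple : ∀ᵐ ω ∂P, IsSimpleCounting (N ω)

/-- A homogeneous Poisson process on the line, of intensity `c`. -/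
structure IsPoissonProcess {Ω : Type*} [MeasurableSpace Ω] (P : Measure Ω) (R : Ω → Measure ℝ)
    (c : ℝ≥0) : Prop where
  isSimplePointProcess : IsSimplePointProcess P R
  /-- The number of points in `B` is a Poisson variable of mean `c` times the length of `B`. -/
  law : ∀ B : Set ℝ, MeasurableSet B → volume B ≠ ∞ →
    P.map (fun ω => R ω B)
      = (poissonMeasure (c * (volume B).toNNReal)).map (fun n : ℕ => (n : ℝ≥0∞))
  /-- The numbers of points in disjoint sets are independent. -/
  indep : ∀ (n : ℕ) (B : Fin n → Set ℝ), (∀ i, MeasurableSet (B i)) →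
    Pairwise (fun i j => Disjoint (B i) (B j)) → iIndepFun (fun i ω => R ω (B i)) P

/-- The graph with vertex set `V` and edge set `E` is a perfect matching of `V`: a simple graph in
which every vertex has degree one. -/
def IsPerfectMatching (V : Set ℝ) (E : Set (Sym2 ℝ)) : Prop :=
  (∀ e ∈ E, ¬ e.IsDiag ∧ ∀ x ∈ e, x ∈ V) ∧ ∀ x ∈ V, ∃! y, s(x, y) ∈ E

/-- A one-color matching scheme of `R`: a simple point process `M` of unordered pairs, on the same
probability space, which almost surely forms a perfect matching of the points of `R`. -/
structure IsMatchingScheme {Ω : Type*} [MeasurableSpace Ω] (P : Measure Ω)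
    (R : Ω → Measure ℝ) (M : Ω → Measure (Sym2 ℝ)) : Prop where
  isSimplePointProcess : IsSimplePointProcess P M
  isPerfectMatching : ∀ᵐ ω ∂P, IsPerfectMatching (supp (R ω)) (supp (M ω))

/-- The law of the joint process `(R, M)` is invariant under the isometry `φ` of the line. -/
def IsInvariantUnder {Ω : Type*} [MeasurableSpace Ω] (P : Measure Ω)
    (R : Ω → Measure ℝ) (M : Ω → Measure (Sym2 ℝ)) (φ : ℝ ≃ᵢ ℝ) : Prop :=
  P.map (fun ω => ((R ω).map φ, (M ω).map (Sym2.map φ))) = P.map (fun ω => (R ω, M ω))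

def IsTranslationInvariant {Ω : Type*} [MeasurableSpace Ω] (P : Measure Ω)
    (R : Ω → Measure ℝ) (M : Ω → Measure (Sym2 ℝ)) : Prop :=
  ∀ t : ℝ, IsInvariantUnder P R M (IsometryEquiv.addRight t)

def IsIsometryInvariant {Ω : Type*} [MeasurableSpace Ω] (P : Measure Ω)
    (R : Ω → Measure ℝ) (M : Ω → Measure (Sym2 ℝ)) : Prop :=
  ∀ φ : ℝ ≃ᵢ ℝ, IsInvariantUnder P R M φ

/-- `M` is a factor of `R`: almost surely a deterministic measurable function of `R`. -/
def IsFactor {Ω : Type*} [MeasurableSpace Ω] (P : Measure Ω)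
    (R : Ω → Measure ℝ) (M : Ω → Measure (Sym2 ℝ)) : Prop :=
  ∃ f : Measure ℝ → Measure (Sym2 ℝ), Measurable f ∧ ∀ᵐ ω ∂P, M ω = f (R ω)

/-- `F r` is the expected number of points of `R` in `[0, 1)` whose partner in the matching `M`
is at distance at most `r`. -/
noncomputable def F {Ω : Type*} [MeasurableSpace Ω] (P : Measure Ω)
    (R : Ω → Measure ℝ) (M : Ω → Measure (Sym2 ℝ)) (r : ℝ) : ℝ≥0∞ :=
  ∫⁻ ω, (({x : ℝ | x ∈ supp (R ω) ∧ x ∈ Set.Ico (0 : ℝ) 1 ∧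
    ∃ y, s(x, y) ∈ supp (M ω) ∧ |x - y| ≤ r}.encard : ℕ∞) : ℝ≥0∞) ∂P

/-- `ν` is the law, under `P*`, of the typical matching distance `X`: the probability measure on
the line with distribution function `F`. -/
structure IsTypicalDistanceLaw {Ω : Type*} [MeasurableSpace Ω] (P : Measure Ω)
    (R : Ω → Measure ℝ) (M : Ω → Measure (Sym2 ℝ)) (ν : Measure ℝ) : Prop where
  isProbabilityMeasure : IsProbabilityMeasure ν
  cdf_eq : ∀ r : ℝ, ν (Set.Iic r) = F P R M r

/-- The law of the typical distance is unique. -/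
theorem IsTypicalDistanceLaw.unique {Ω : Type*} [MeasurableSpace Ω] {P : Measure Ω}
    {R : Ω → Measure ℝ} {M : Ω → Measure (Sym2 ℝ)} {ν ν' : Measure ℝ}
    (h : IsTypicalDistanceLaw P R M ν) (h' : IsTypicalDistanceLaw P R M ν') : ν = ν' := by
  have := h.isProbabilityMeasure
  exact Measure.ext_of_Iic ν ν' fun r => (h.cdf_eq r).trans (h'.cdf_eq r).symm

end PoissonMatching

universe u

/-! Part (i) is a parity argument. Let `N t` be the number of pairs that cross `t`. Cutting the
pairs that cross `0` by the unit interval of their lower endpoint, and translating that interval to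
`[0, 1)`, gives `E (N 0) ≤ 1 + E* X` (`IsMatchingScheme.lintegral_crossing_le`). If `E* X` were
finite, `N 0` would be almost surely finite, and for a factor the sign `(-1) ^ N 0` would be a
function `φ` of the configuration. A pair with both ends in `[0, t)`, or with both ends outside,
does not change the parity of `N 0 + N t`, so `φ(R)` times `φ` of the translated configuration is
`(-1) ^ R[0, t)` (`cos_crossing_mul`).

This is impossible (`IsPoissonProcess.not_sign_eq_mul`): `φ` is close in mean to a function of the
points in a window `[-n, n)`. For `t = 2n + 1` the window and its translate leave the gap `[n, n +
1)` free, and the independent sign of the gap has mean `exp (-2)`. The product of the local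
approximations therefore has small correlation with `(-1) ^ R[0, t)`, although that correlation
should be near `1`.

For part (ii), a fair coin chooses one of the two matchings of adjacent points. An isometry fixes or
exchanges the two (`IsBiinfinite.map_alternate`, `alternate_eq_or`), so the coin makes the joint law
invariant; no function of `R` can be both matchings. Averaged over the coin, each point has its
right or its left neighbor as partner with weight one half. The mean number of points of `[0, 1)`
with no neighbor within `r` on a given side is `exp (-r)` (`IsPoissonProcess.lintegral_isolated`).
-/

namespace PoissonMatching

/-! ### Measurability of maps on unordered pairs -/

theorem measurable_sym2_mk : Measurable (fun p : ℝ × ℝ => s(p.1, p.2)) := measurable_quot_mk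

/-- The sigma-algebra on unordered pairs is the quotient one, so measurability can be tested on
ordered pairs. -/
theorem measurable_sym2_iff {β : Type*} [MeasurableSpace β] {f : Sym2 ℝ → β} :
    Measurable f ↔ Measurable (fun p : ℝ × ℝ => f s(p.1, p.2)) :=
  ⟨fun h => h.comp measurable_sym2_mk, fun h => fun _ hs => h hs⟩

instance : MeasurableSingletonClass (Sym2 ℝ) where
  measurableSet_singleton e := by
    induction e with | _ a b
    have : (fun p : ℝ × ℝ => s(p.1, p.2)) ⁻¹' {s(a, b)} = {(a, b), (b, a)} := by
      ext ⟨x, y⟩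
      simp
    change MeasurableSet ((fun p : ℝ × ℝ => s(p.1, p.2)) ⁻¹' {s(a, b)})
    rw [this]
    exact (Set.toFinite _).measurableSet

theorem measurable_sym2_map {f : ℝ → ℝ} (hf : Measurable f) : Measurable (Sym2.map f) :=
  measurable_sym2_iff.2 <|
    measurable_sym2_mk.comp ((hf.comp measurable_fst).prodMk (hf.comp measurable_snd))

theorem measurable_sym2_inf : Measurable (Sym2.inf : Sym2 ℝ → ℝ) :=
  measurable_sym2_iff.2 (measurable_fst.inf measurable_snd)

theorem measurable_sym2_sup : Measurable (Sym2.sup : Sym2 ℝ → ℝ) :=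
  measurable_sym2_iff.2 (measurable_fst.sup measurable_snd)

/-- The length of an unordered pair. -/
noncomputable def length (e : Sym2 ℝ) : ℝ := e.sup - e.inf

theorem length_mk (a b : ℝ) : length s(a, b) = |a - b| := by
  simp [length, max_sub_min_eq_abs']

theorem measurable_length : Measurable length := measurable_sym2_sup.sub measurable_sym2_inf

/-! ### Simple counting measures -/

section Counting

theorem encard_eq_tsum_indicator {E : Type*} (V A : Set E) :
    ((V ∩ A).encard : ℝ≥0∞) = ∑' x : V, A.indicator 1 (x : E) := by
  rw [← ENNReal.tsum_set_one, tsum_subtype (V ∩ A) (fun _ => (1 : ℝ≥0∞)),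
    tsum_subtype V (A.indicator 1)]
  refine tsum_congr fun x => ?_
  by_cases hV : x ∈ V <;> by_cases hA : x ∈ A <;> simp [hV, hA]

variable {E : Type*} [MeasurableSpace E]

theorem sum_dirac_apply (S : Set E) {C : Set E} (hC : MeasurableSet C) :
    Measure.sum (fun x : S => Measure.dirac (x : E)) C = ((S ∩ C).encard : ℝ≥0∞) := by
  rw [Measure.sum_apply _ hC, encard_eq_tsum_indicator]
  exact tsum_congr fun x => Measure.dirac_apply' _ hC

variable [MeasurableSingletonClass E]

theorem supp_sum_dirac (S : Set E) :
    supp (Measure.sum (fun x : S => Measure.dirac (x : E))) = S := by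
  ext x
  rw [supp, Set.mem_ofPred_eq, sum_dirac_apply S (measurableSet_singleton x)]
  by_cases hx : x ∈ S
  · simp [hx, Set.inter_eq_self_of_subset_right (Set.singleton_subset_iff.2 hx)]
  · simp [hx, Set.inter_singleton_eq_empty.2 hx]

variable [TopologicalSpace E] {μ : Measure E}

/-- The set in the definition can only be the support; this removes the existential from all later
arguments. -/
theorem IsSimpleCounting.eq_sum (h : IsSimpleCounting μ) :
    μ = Measure.sum (fun x : supp μ => Measure.dirac (x : E)) := by
  obtain ⟨_, S, hS, hμ⟩ := h
  have : supp μ = S := by rw [hμ, supp_sum_dirac]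
  rw [this]; exact hμ

theorem IsSimpleCounting.countable_supp (h : IsSimpleCounting μ) : (supp μ).Countable := by
  obtain ⟨_, S, hS, hμ⟩ := h
  rwa [hμ, supp_sum_dirac]

theorem IsSimpleCounting.apply (h : IsSimpleCounting μ) {C : Set E} (hC : MeasurableSet C) :
    μ C = ((supp μ ∩ C).encard : ℝ≥0∞) := by
  conv_lhs => rw [h.eq_sum]
  exact sum_dirac_apply _ hC

theorem IsSimpleCounting.lintegral (h : IsSimpleCounting μ) (f : E → ℝ≥0∞) :
    ∫⁻ x, f x ∂μ = ∑' x : supp μ, f x := by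
  conv_lhs => rw [h.eq_sum]
  simp [lintegral_sum_measure]

end Counting

/-! ### Summation over a perfect matching -/

/-- Double counting: a vertex is the same thing as an edge together with one of its two endpoints.
-/
theorem IsPerfectMatching.tsum_eq {V : Set ℝ} {E : Set (Sym2 ℝ)} (h : IsPerfectMatching V E)
    {p : ℝ → ℝ} (hp : ∀ x ∈ V, s(x, p x) ∈ E) (f : ℝ → ℝ → ℝ≥0∞) :
    ∑' x : V, f x (p x) =
      ∑' e : E, Sym2.lift ⟨fun a b => f a b + f b a, fun _ _ => add_comm _ _⟩ (e : Sym2 ℝ) := by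
  have huniq : ∀ x ∈ V, ∀ y, s(x, y) ∈ E → y = p x := fun x hx y hy =>
    (h.2 x hx).unique hy (hp x hx)
  let φ : V ≃ Σ e : E, {x : ℝ // x ∈ (e : Sym2 ℝ)} :=
    { toFun := fun x => ⟨⟨s(x, p x), hp x x.2⟩, ⟨x, Sym2.mem_mk_left _ _⟩⟩
      invFun := fun z => ⟨z.2.1, (h.1 z.1 z.1.2).2 _ z.2.2⟩
      left_inv := fun x => rfl
      right_inv := by
        rintro ⟨⟨e, he⟩, ⟨x, hx⟩⟩
        have hxV := (h.1 e he).2 x hx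
        obtain ⟨y, rfl⟩ := Sym2.mem_iff_exists.1 hx
        obtain rfl := huniq x hxV y he
        rfl }
  rw [← φ.symm.tsum_eq (fun x : V => f x (p x)), ENNReal.tsum_sigma']
  refine tsum_congr ?_
  rintro ⟨e, he⟩
  induction e with | _ a b
  have hab : a ≠ b := fun hab => (h.1 _ he).1 (by simpa using hab)
  have ha := (h.1 _ he).2 a (Sym2.mem_mk_left _ _)
  have hb := (h.1 _ he).2 b (Sym2.mem_mk_right _ _)
  have hpa := huniq a ha b he
  have hpb := huniq b hb a (by rwa [Sym2.eq_swap])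
  change ∑' x : {x : ℝ // x ∈ s(a, b)}, f x (p x) = f a b + f b a
  have hset : {x : ℝ | x ∈ s(a, b)} = (({a, b} : Finset ℝ) : Set ℝ) := by ext; simp
  calc ∑' x : {x : ℝ // x ∈ s(a, b)}, f x (p x)
      = ∑' x : (({a, b} : Finset ℝ) : Set ℝ), f x (p x) :=
        tsum_congr_set_coe (fun x => f x (p x)) hset
    _ = f a b + f b a := by
      rw [Finset.tsum_subtype' {a, b} (fun x => f x (p x)), Finset.sum_pair hab, ← hpa, ← hpb]

/-- The points of the matching in `A` whose partner is at a distance in `B`. -/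
def matchedAt (V : Set ℝ) (E : Set (Sym2 ℝ)) (A B : Set ℝ) : Set ℝ :=
  {x | x ∈ V ∧ x ∈ A ∧ ∃ y, s(x, y) ∈ E ∧ |x - y| ∈ B}

/-- The number of endpoints in `A` of a pair whose length is in `B`. -/
noncomputable def endpoints (A B : Set ℝ) : Sym2 ℝ → ℝ≥0∞ :=
  Sym2.lift ⟨fun a b => A.indicator 1 a * B.indicator 1 |a - b| +
    A.indicator 1 b * B.indicator 1 |b - a|, fun _ _ => add_comm _ _⟩

theorem endpoints_mk (A B : Set ℝ) (a b : ℝ) : endpoints A B s(a, b) =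
    A.indicator 1 a * B.indicator 1 |a - b| + A.indicator 1 b * B.indicator 1 |b - a| := rfl

/-- Both endpoints see the same distance, so the condition on it factors out. This is what presents
the law of the distance as an image under `length`. -/
theorem endpoints_eq_mul (A B : Set ℝ) (e : Sym2 ℝ) :
    endpoints A B e = endpoints A Set.univ e * B.indicator 1 (length e) := by
  induction e with | _ a b
  rw [endpoints_mk, endpoints_mk, length_mk, abs_sub_comm b a]
  simp [add_mul]

theorem measurable_endpoints {A B : Set ℝ} (hA : MeasurableSet A) (hB : MeasurableSet B) :
    Measurable (endpoints A B) := by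
  refine measurable_sym2_iff.2 ?_
  simp only [endpoints_mk]
  have hA' : Measurable (A.indicator (1 : ℝ → ℝ≥0∞)) := measurable_one.indicator hA
  have hB' : Measurable (B.indicator (1 : ℝ → ℝ≥0∞)) := measurable_one.indicator hB
  fun_prop

/-- The right-hand side depends measurably on `M` when `A` and `B` are measurable, which is not
evident for the count of points. -/
theorem IsPerfectMatching.encard_matchedAt {V : Set ℝ} {M : Measure (Sym2 ℝ)}
    (hM : IsSimpleCounting M) (h : IsPerfectMatching V (supp M)) (A B : Set ℝ) :
    ((matchedAt V (supp M) A B).encard : ℝ≥0∞) = ∫⁻ e, endpoints A B e ∂M := by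
  choose! p hp using fun x hx => (h.2 x hx).exists
  have huniq : ∀ x ∈ V, ∀ y, s(x, y) ∈ supp M → y = p x := fun x hx y hy =>
    (h.2 x hx).unique hy (hp x hx)
  rw [hM.lintegral]
  refine Eq.trans ?_ (h.tsum_eq hp fun a b => A.indicator 1 a * B.indicator 1 |a - b|)
  have : matchedAt V (supp M) A B = V ∩ {x | x ∈ A ∧ |x - p x| ∈ B} := by
    ext x
    simp only [matchedAt, Set.mem_ofPred_eq, Set.mem_inter_iff]
    refine and_congr_right fun hx => and_congr_right fun _ => ⟨?_, fun hB => ⟨p x, hp x hx, hB⟩⟩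
    rintro ⟨y, hy, hB⟩
    rwa [← huniq x hx y hy]
  rw [this, encard_eq_tsum_indicator]
  refine tsum_congr fun x => ?_
  by_cases hA : (x : ℝ) ∈ A <;> by_cases hB : |(x : ℝ) - p x| ∈ B <;> simp [hA, hB]

/-! ### The law of the typical distance -/

section Typical

variable {Ω : Type*} [MeasurableSpace Ω] {P : Measure Ω} {R : Ω → Measure ℝ}
  {M : Ω → Measure (Sym2 ℝ)}

theorem IsMatchingScheme.measurable (hM : IsMatchingScheme P R M) : Measurable M :=
  hM.isSimplePointProcess.measurable

theorem IsMatchingScheme.ae_isSimpleCounting (hM : IsMatchingScheme P R M) :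
    ∀ᵐ ω ∂P, IsSimpleCounting (M ω) :=
  hM.isSimplePointProcess.simple

theorem IsMatchingScheme.ae_encard (h : IsMatchingScheme P R M) (A B : Set ℝ) :
    ∀ᵐ ω ∂P, ((matchedAt (supp (R ω)) (supp (M ω)) A B).encard : ℝ≥0∞) =
      ∫⁻ e, endpoints A B e ∂(M ω) := by
  filter_upwards [h.isPerfectMatching, h.ae_isSimpleCounting] with ω h1 h2
  exact h1.encard_matchedAt h2 A B

theorem IsPerfectMatching.matchedAt_univ {V : Set ℝ} {E : Set (Sym2 ℝ)}
    (h : IsPerfectMatching V E) (A : Set ℝ) : matchedAt V E A Set.univ = V ∩ A := by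
  ext x
  simp only [matchedAt, Set.mem_ofPred_eq, Set.mem_inter_iff, Set.mem_univ, and_true]
  exact ⟨fun h => ⟨h.1, h.2.1⟩, fun hx => ⟨hx.1, hx.2, (h.2 x hx.1).exists⟩⟩

theorem IsMatchingScheme.ae_apply (hR : IsSimplePointProcess P R) (h : IsMatchingScheme P R M)
    {A : Set ℝ} (hA : MeasurableSet A) :
    ∀ᵐ ω ∂P, R ω A = ∫⁻ e, endpoints A Set.univ e ∂(M ω) := by
  filter_upwards [h.isPerfectMatching, h.ae_isSimpleCounting, hR.simple] with ω h1 h2 h3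
  rw [← h1.encard_matchedAt h2, h1.matchedAt_univ, h3.apply hA]

theorem IsMatchingScheme.exists_law (hR : IsSimplePointProcess P R) (h : IsMatchingScheme P R M)
    (hmean : ∫⁻ ω, R ω (Set.Ico 0 1) ∂P = 1) :
    ∃ ν : Measure ℝ, IsTypicalDistanceLaw P R M ν ∧ ∀ B, MeasurableSet B →
      ν B = ∫⁻ ω, ((matchedAt (supp (R ω)) (supp (M ω)) (Set.Ico 0 1) B).encard : ℝ≥0∞) ∂P := by
  have hm := measurable_endpoints (measurableSet_Ico (a := (0 : ℝ)) (b := 1)) MeasurableSet.univ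
  -- The candidate law: the intensity measure of the pairs, weighted by the number of endpoints in
  -- `[0, 1)` and pushed forward by the length. Its total mass is the mean number of points in `[0,
  -- 1)`.
  have key : ∀ B, MeasurableSet B →
      (((P.bind M).withDensity (endpoints (Set.Ico 0 1) Set.univ)).map length) B =
      ∫⁻ ω, ((matchedAt (supp (R ω)) (supp (M ω)) (Set.Ico 0 1) B).encard : ℝ≥0∞) ∂P := by
    intro B hB
    rw [Measure.map_apply measurable_length hB,
      withDensity_apply _ (measurable_length hB), ← lintegral_indicator (measurable_length hB),
      Measure.lintegral_bind h.measurable.aemeasurable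
        (hm.indicator (measurable_length hB)).aemeasurable]
    refine lintegral_congr_ae ?_
    filter_upwards [h.ae_encard (Set.Ico 0 1) B] with ω hω
    rw [hω]
    refine lintegral_congr fun e => ?_
    rw [endpoints_eq_mul _ B]
    by_cases he : length e ∈ B <;> simp [he]
  refine ⟨_, ⟨⟨?_⟩, fun r => ?_⟩, key⟩
  · rw [key _ .univ, ← hmean]
    refine lintegral_congr_ae ?_
    filter_upwards [h.ae_apply hR (measurableSet_Ico (a := (0 : ℝ)) (b := 1)),
      h.ae_encard (Set.Ico 0 1) Set.univ] with ω h1 h2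
    rw [h1, h2]
  · rw [key _ measurableSet_Iic]
    rfl

end Typical

/-! ### Atoms of a finite family of sets -/

/-- The set of points that belong to exactly those members `g k` of the family with `τ k`. -/
def atom {α κ : Type*} (g : κ → Set α) (τ : κ → Prop) : Set α := {x | ∀ k, x ∈ g k ↔ τ k}

theorem measurableSet_atom {α κ : Type*} [MeasurableSpace α] [Finite κ] {g : κ → Set α}
    (hg : ∀ k, MeasurableSet (g k)) (τ : κ → Prop) : MeasurableSet (atom g τ) := by
  have : atom g τ = ⋂ k, {x | x ∈ g k ↔ τ k} := by ext; simp [atom]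
  rw [this]
  refine MeasurableSet.iInter fun k => ?_
  by_cases h : τ k
  · simpa [h] using hg k
  · simp only [h, iff_false]
    exact (hg k).compl

theorem disjoint_atom {α κ : Type*} (g : κ → Set α) {τ τ' : κ → Prop} (h : τ ≠ τ') :
    Disjoint (atom g τ) (atom g τ') :=
  Set.disjoint_left.2 fun _ hx hx' => h (funext fun k => propext ((hx k).symm.trans (hx' k)))

open Classical in
theorem measure_inter_eq_sum_atom {α κ : Type*} [MeasurableSpace α] [Fintype κ] {g : κ → Set α}
    (hg : ∀ k, MeasurableSet (g k)) {A : Set α} (hA : MeasurableSet A) (μ : Measure α) (k : κ) :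
    μ (A ∩ g k) = ∑ τ : κ → Prop, if τ k then μ (A ∩ atom g τ) else 0 := by
  rw [← Finset.sum_filter, ← measure_biUnion_finset
    (fun τ _ τ' _ h => (disjoint_atom g h).mono Set.inter_subset_right Set.inter_subset_right)
    (fun τ _ => hA.inter (measurableSet_atom hg τ))]
  congr 1
  ext x
  simp only [Set.mem_inter_iff, Finset.mem_filter, Finset.mem_univ, true_and, Set.mem_iUnion,
    exists_prop]
  constructor
  · rintro ⟨h1, h2⟩
    exact ⟨fun j => x ∈ g j, h2, h1, fun _ => Iff.rfl⟩
  · rintro ⟨τ, h1, h2, h3⟩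
    exact ⟨h2, (h3 k).2 h1⟩

/-! ### Independence and the law of a Poisson process -/

section Poisson

variable {Ω : Type*} [MeasurableSpace Ω] {P : Measure Ω} {R : Ω → Measure ℝ} {c : ℝ≥0}

theorem IsPoissonProcess.measurable (hR : IsPoissonProcess P R c) : Measurable R :=
  hR.isSimplePointProcess.measurable

theorem IsPoissonProcess.measurable_apply (hR : IsPoissonProcess P R c) {B : Set ℝ}
    (hB : MeasurableSet B) : Measurable fun ω => R ω B :=
  (Measure.measurable_coe hB).comp hR.measurable

theorem IsPoissonProcess.iIndepFun (hR : IsPoissonProcess P R c) {ι : Type*} [Fintype ι]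
    (B : ι → Set ℝ) (hB : ∀ i, MeasurableSet (B i))
    (hd : Pairwise fun i j => Disjoint (B i) (B j)) : iIndepFun (fun i ω => R ω (B i)) P := by
  let e := Fintype.equivFin ι
  have := (hR.indep _ (fun i => B (e.symm i)) (fun i => hB _)
    (fun i j hij => hd (e.symm.injective.ne hij))).precomp e.injective
  simpa using this

open Classical in
-- The sets `A ∩ g k` may overlap, but their counts are sums of counts over disjoint atoms, to which
-- the independence axiom applies. The index `none` stands for `B`.
theorem IsPoissonProcess.indepFun_finite (hR : IsPoissonProcess P R c) {κ : Type*} [Fintype κ]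
    {g : κ → Set ℝ} (hg : ∀ k, MeasurableSet (g k)) {A B : Set ℝ} (hA : MeasurableSet A)
    (hB : MeasurableSet B) (hAB : Disjoint A B) :
    IndepFun (fun ω k => R ω (A ∩ g k)) (fun ω => R ω B) P := by
  let D : Option (κ → Prop) → Set ℝ := fun o => o.elim B fun τ => A ∩ atom g τ
  have hD : ∀ o, MeasurableSet (D o) := by
    rintro (_ | τ)
    exacts [hB, hA.inter (measurableSet_atom hg τ)]
  have hd : Pairwise fun i j => Disjoint (D i) (D j) := by
    rintro (_ | τ) (_ | τ') h
    · exact absurd rfl h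
    · exact hAB.symm.mono_right Set.inter_subset_left
    · exact hAB.mono_left Set.inter_subset_left
    · exact (disjoint_atom g (fun h' => h (by rw [h']))).mono
        Set.inter_subset_right Set.inter_subset_right
  have hi := iIndepFun.indepFun_finset (f := fun o ω => R ω (D o)) (Finset.univ.erase none) {none}
    (by simp) (hR.iIndepFun D hD hd) (fun o => hR.measurable_apply (hD o))
  have hφ : Measurable fun (v : {o // o ∈ Finset.univ.erase none} → ℝ≥0∞) (k : κ) =>
      ∑ τ : κ → Prop, if τ k then v ⟨some τ, by simp⟩ else 0 :=
    measurable_pi_lambda _ fun k => Finset.measurable_sum _ fun τ _ => by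
      split_ifs
      · exact measurable_pi_apply _
      · exact measurable_const
  have hψ : Measurable fun v : {o // o ∈ ({none} : Finset (Option (κ → Prop)))} → ℝ≥0∞ =>
      v ⟨none, by simp⟩ := measurable_pi_apply _
  have h2 := hi.comp hφ hψ
  refine h2.congr (Filter.Eventually.of_forall fun ω => ?_)
    (Filter.Eventually.of_forall fun ω => rfl)
  funext k
  exact (measure_inter_eq_sum_atom hg hA (R ω) k).symm

/-- The restricted configuration generates the directed supremum of the sigma-algebras of finitely
many counts, and independence passes to such a supremum. -/
theorem IsPoissonProcess.indepFun_restrict [IsProbabilityMeasure P]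
    (hR : IsPoissonProcess P R c) {A B : Set ℝ}
    (hA : MeasurableSet A) (hB : MeasurableSet B) (hAB : Disjoint A B) :
    IndepFun (fun ω => (R ω).restrict A) (fun ω => R ω B) P := by
  classical
  rw [IndepFun_iff_Indep]
  let ι := {s : Set ℝ // MeasurableSet s}
  let m : Finset ι → MeasurableSpace Ω := fun F =>
    MeasurableSpace.comap (fun ω (k : F) => R ω (A ∩ k.1.1)) inferInstance
  have hm : ∀ F, Indep (m F) (MeasurableSpace.comap (fun ω => R ω B) inferInstance) P := fun F =>
    (IndepFun_iff_Indep _ _ _).1 (hR.indepFun_finite (κ := {x // x ∈ F}) (g := fun k => k.1.1)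
      (fun k => k.1.2) hA hB hAB)
  have hmeas : ∀ F : Finset ι, Measurable (fun ω (k : F) => R ω (A ∩ k.1.1)) := fun F =>
    measurable_pi_lambda _ fun k => hR.measurable_apply (hA.inter k.1.2)
  have hmono : Monotone m := by
    intro F G hFG
    have : (fun ω (k : F) => R ω (A ∩ k.1.1)) =
        (fun v (k : F) => v ⟨k.1, hFG k.2⟩) ∘ (fun ω (k : G) => R ω (A ∩ k.1.1)) := rfl
    simp only [m]
    rw [this, ← MeasurableSpace.comap_comp]
    exact MeasurableSpace.comap_mono
      (measurable_pi_lambda _ fun k => measurable_pi_apply _).comap_le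
  refine indep_of_indep_of_le_left (indep_iSup_of_directed_le hm
    (fun F => (hmeas F).comap_le) (hR.measurable_apply hB).comap_le hmono.directed_le) ?_
  rw [Measure.instMeasurableSpace, MeasurableSpace.comap_iSup]
  refine iSup_le fun s => ?_
  rw [MeasurableSpace.comap_iSup]
  refine iSup_le fun hs => ?_
  refine le_trans ?_ (le_iSup m {⟨s, hs⟩})
  rw [MeasurableSpace.comap_comp]
  have : (fun μ : Measure ℝ => μ s) ∘ (fun ω => (R ω).restrict A) =
      (fun v : ({⟨s, hs⟩} : Finset ι) → ℝ≥0∞ => v ⟨⟨s, hs⟩, by simp⟩) ∘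
        (fun ω (k : ({⟨s, hs⟩} : Finset ι)) => R ω (A ∩ k.1.1)) := by
    funext ω
    simp [Measure.restrict_apply hs, Set.inter_comm]
  rw [this, ← MeasurableSpace.comap_comp]
  refine MeasurableSpace.comap_mono ?_
  rw [← BorelSpace.measurable_eq]
  exact (measurable_pi_apply _).comap_le

open Classical in
-- The right-hand side involves only `c` and the sets, so two Poisson processes of the same
-- intensity share their finite-dimensional laws.
theorem IsPoissonProcess.map_finite [IsProbabilityMeasure P] (hR : IsPoissonProcess P R c)
    {κ : Type*} [Fintype κ] {g : κ → Set ℝ} (hg : ∀ k, MeasurableSet (g k))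
    (hv : ∀ k, volume (g k) ≠ ∞) :
    P.map (fun ω k => R ω (g k)) =
      (Measure.pi fun τ : κ → Prop =>
        (poissonMeasure (c * (volume ((⋃ k, g k) ∩ atom g τ)).toNNReal)).map
          (fun n : ℕ => (n : ℝ≥0∞))).map
        fun v k => ∑ τ : κ → Prop, if τ k then v τ else 0 := by
  have hA : MeasurableSet (⋃ k, g k) := MeasurableSet.iUnion hg
  have hvA : volume (⋃ k, g k) ≠ ∞ :=
    ((measure_iUnion_fintype_le _ _).trans_lt (ENNReal.sum_lt_top.2 fun k _ => (hv k).lt_top)).ne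
  let ψ : ((κ → Prop) → ℝ≥0∞) → κ → ℝ≥0∞ := fun v k => ∑ τ : κ → Prop, if τ k then v τ else 0
  have hψ : Measurable ψ := measurable_pi_lambda _ fun k => Finset.measurable_sum _ fun τ _ => by
    split_ifs
    · exact measurable_pi_apply _
    · exact measurable_const
  have hD : ∀ τ, MeasurableSet ((⋃ k, g k) ∩ atom g τ) :=
    fun τ => hA.inter (measurableSet_atom hg τ)
  have h1 : (fun ω k => R ω (g k)) = ψ ∘ (fun ω τ => R ω ((⋃ k, g k) ∩ atom g τ)) := by
    funext ω k
    have := measure_inter_eq_sum_atom hg hA (R ω) k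
    rwa [Set.inter_eq_self_of_subset_right (Set.subset_iUnion g k)] at this
  rw [h1, ← Measure.map_map hψ
    (measurable_pi_lambda _ fun τ => hR.measurable_apply (hD τ)),
    (hR.iIndepFun (fun τ => (⋃ k, g k) ∩ atom g τ) hD fun τ τ' h => (disjoint_atom g h).mono
      Set.inter_subset_right Set.inter_subset_right).map_fun_eq_pi_map
      fun τ => (hR.measurable_apply (hD τ)).aemeasurable]
  congr 2
  funext τ
  exact hR.law _ (hD τ) (measure_ne_top_of_subset Set.inter_subset_left hvA)

theorem measure_eq_iSup_inter_Icc (μ : Measure ℝ) (s : Set ℝ) :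
    μ s = ⨆ n : ℕ, μ (s ∩ Set.Icc (-n : ℝ) n) := by
  have hU : s = ⋃ n : ℕ, s ∩ Set.Icc (-n : ℝ) n := by
    rw [← Set.inter_iUnion]
    refine (Set.inter_eq_self_of_subset_left fun x _ => ?_).symm
    obtain ⟨n, hn⟩ := exists_nat_ge |x|
    exact Set.mem_iUnion.2 ⟨n, abs_le.1 hn⟩
  conv_lhs => rw [hU]
  refine Monotone.measure_iUnion fun n m hnm => Set.inter_subset_inter_right _ ?_
  have : (n : ℝ) ≤ m := by exact_mod_cast hnm
  exact Set.Icc_subset_Icc (by linarith) this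

/-- The law of a Poisson process is determined by its intensity. -/
theorem IsPoissonProcess.map_eq [IsProbabilityMeasure P] {Ω' : Type*} [MeasurableSpace Ω']
    {P' : Measure Ω'} [IsProbabilityMeasure P'] {R' : Ω' → Measure ℝ}
    (hR : IsPoissonProcess P R c) (hR' : IsPoissonProcess P' R' c) : P.map R = P'.map R' := by
  -- The Poisson law is prescribed only for sets of finite length. They suffice, since every count
  -- is a supremum of counts in `s ∩ [-n, n]`.
  let ι := {s : Set ℝ // MeasurableSet s ∧ volume s ≠ ∞}
  let Φ : Measure ℝ → ι → ℝ≥0∞ := fun μ s => μ s.1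
  have hΦ : Measurable Φ := measurable_pi_lambda _ fun s => Measure.measurable_coe s.2.1
  have hlaw : (P.map R).map Φ = (P'.map R').map Φ := by
    rw [Measure.map_map hΦ hR.measurable, Measure.map_map hΦ hR'.measurable]
    have h1 := hΦ.comp hR.measurable
    have h2 := hΦ.comp hR'.measurable
    have : IsProbabilityMeasure (P.map (Φ ∘ R)) := Measure.isProbabilityMeasure_map h1.aemeasurable
    refine IsProjectiveLimit.unique (P := fun I : Finset ι => (P.map (Φ ∘ R)).map I.restrict)
      (fun I => rfl) fun I => ?_
    have hI : Measurable (I.restrict (π := fun _ : ι => ℝ≥0∞)) := Finset.measurable_restrict I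
    rw [Measure.map_map hI h2]
    change _ = (P.map (Φ ∘ R)).map I.restrict
    rw [Measure.map_map hI h1]
    have hg : ∀ k : I, MeasurableSet k.1.1 := fun k => k.1.2.1
    have hv : ∀ k : I, volume k.1.1 ≠ ∞ := fun k => k.1.2.2
    exact (hR'.map_finite hg hv).trans (hR.map_finite hg hv).symm
  have hle : (Measure.instMeasurableSpace : MeasurableSpace (Measure ℝ)) ≤
      MeasurableSpace.comap Φ inferInstance := by
    refine iSup_le fun s => iSup_le fun hs => ?_
    rw [← BorelSpace.measurable_eq]
    refine Measurable.comap_le ?_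
    have h1 : (fun μ : Measure ℝ => μ s) = fun μ => ⨆ n : ℕ, μ (s ∩ Set.Icc (-n : ℝ) n) :=
      funext fun μ => measure_eq_iSup_inter_Icc μ s
    rw [h1]
    refine Measurable.iSup fun n => ?_
    have h2 : (fun μ : Measure ℝ => μ (s ∩ Set.Icc (-n : ℝ) n)) =
        (fun v : ι → ℝ≥0∞ => v ⟨s ∩ Set.Icc (-n : ℝ) n, hs.inter measurableSet_Icc,
          measure_ne_top_of_subset Set.inter_subset_right (by simp)⟩) ∘ Φ := rfl
    rw [h2]
    exact (measurable_pi_apply _).comp (comap_measurable Φ)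
  refine Measure.ext fun C hC => ?_
  obtain ⟨D, hD, rfl⟩ := hle C hC
  rw [← Measure.map_apply hΦ hD, hlaw, Measure.map_apply hΦ hD]

theorem IsSimpleCounting.map_isometry {μ : Measure ℝ} (h : IsSimpleCounting μ) (φ : ℝ ≃ᵢ ℝ) :
    IsSimpleCounting (μ.map φ) := by
  have hφ : Measurable φ := φ.continuous.measurable
  have hl := h.1
  refine ⟨⟨fun x => ?_⟩, φ '' supp μ, h.countable_supp.image _, ?_⟩
  · obtain ⟨U, hU, hfin⟩ := μ.finiteAt_nhds (φ.symm x)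
    refine ⟨φ.symm ⁻¹' U, φ.symm.continuous.continuousAt hU, ?_⟩
    have hU' : φ ⁻¹' (φ.symm ⁻¹' U) = U := by ext; simp
    have := φ.toHomeomorph.measurableEmbedding.map_apply μ (φ.symm ⁻¹' U)
    rw [φ.coe_toHomeomorph, hU'] at this
    rwa [this]
  · refine Measure.ext fun C hC => ?_
    rw [Measure.map_apply hφ hC, sum_dirac_apply _ hC, h.apply (hφ hC),
      ← φ.injective.encard_image, Set.image_inter_preimage]

theorem IsPoissonProcess.map_isometry (hR : IsPoissonProcess P R c) (φ : ℝ ≃ᵢ ℝ) :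
    IsPoissonProcess P (fun ω => (R ω).map φ) c := by
  have hφ : Measurable φ := φ.continuous.measurable
  -- Lebesgue measure is one-dimensional Hausdorff measure, which isometries preserve.
  have hvol : ∀ B, MeasurableSet B → volume (φ ⁻¹' B) = volume B := fun B hB => by
    rw [← hausdorffMeasure_real]
    exact (φ.measurePreserving_hausdorffMeasure 1).measure_preimage hB.nullMeasurableSet
  refine ⟨⟨(Measure.measurable_map φ hφ).comp hR.measurable, ?_⟩, fun B hB hv => ?_,
    fun n B hB hd => ?_⟩
  · exact hR.isSimplePointProcess.simple.mono fun ω hω => hω.map_isometry φ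
  · simp only [Measure.map_apply hφ hB]
    rw [hR.law _ (hφ hB) (by rwa [hvol B hB]), hvol B hB]
  · simp only [fun i ω => Measure.map_apply (μ := R ω) hφ (hB i)]
    exact hR.indep n (fun i => φ ⁻¹' B i) (fun i => hφ (hB i)) fun i j h => (hd h).preimage φ

/-! ### Moments of the number of points in a set -/

theorem lintegral_poissonMeasure (r : ℝ≥0) (f : ℕ → ℝ≥0∞) : ∫⁻ n, f n ∂(poissonMeasure r) =
    ∑' n : ℕ, ENNReal.ofReal (Real.exp (-r) * r ^ n / n.factorial) * f n := by
  simp [poissonMeasure, lintegral_sum_measure]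

theorem lintegral_cast_poissonMeasure (r : ℝ≥0) : ∫⁻ n, (n : ℝ≥0∞) ∂(poissonMeasure r) = r := by
  rw [lintegral_poissonMeasure, tsum_eq_zero_add' ENNReal.summable]
  have h : ∀ n : ℕ, ENNReal.ofReal (Real.exp (-r) * r ^ (n + 1) / (n + 1).factorial) *
      ((n + 1 : ℕ) : ℝ≥0∞) = r * (ENNReal.ofReal (Real.exp (-r) * r ^ n / n.factorial) * 1) := by
    intro n
    rw [← ENNReal.ofReal_natCast, ← ENNReal.ofReal_mul (by positivity), mul_one,
      ← ENNReal.ofReal_coe_nnreal (p := r), ← ENNReal.ofReal_mul (by positivity)]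
    congr 1
    rw [Nat.factorial_succ]
    have : (n.factorial : ℝ) ≠ 0 := by positivity
    push_cast
    field_simp
    ring
  simp_rw [h]
  rw [ENNReal.tsum_mul_left, ← lintegral_poissonMeasure r fun _ => 1]
  simp

theorem IsPoissonProcess.lintegral_apply (hR : IsPoissonProcess P R c) {B : Set ℝ}
    (hB : MeasurableSet B) (hv : volume B ≠ ∞) : ∫⁻ ω, R ω B ∂P = c * volume B := by
  calc ∫⁻ ω, R ω B ∂P = ∫⁻ x, id x ∂(P.map fun ω => R ω B) :=
        (lintegral_map measurable_id (hR.measurable_apply hB)).symm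
    _ = c * volume B := by
        rw [hR.law B hB hv, lintegral_map measurable_id measurable_from_top]
        simp only [id]
        rw [lintegral_cast_poissonMeasure, ENNReal.coe_mul, ENNReal.coe_toNNReal hv]

theorem IsPoissonProcess.prob_eq_zero (hR : IsPoissonProcess P R c) {B : Set ℝ}
    (hB : MeasurableSet B) (hv : volume B ≠ ∞) :
    P {ω | R ω B = 0} = ENNReal.ofReal (Real.exp (-(c * (volume B).toReal))) := by
  have h : P {ω | R ω B = 0} = P.map (fun ω => R ω B) {0} :=
    (Measure.map_apply (hR.measurable_apply hB) (measurableSet_singleton _)).symm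
  have h0 : (fun n : ℕ => (n : ℝ≥0∞)) ⁻¹' {0} = {0} := by ext; simp
  rw [h, hR.law B hB hv, Measure.map_apply measurable_from_top (measurableSet_singleton _), h0,
    poissonMeasure_singleton]
  simp [ENNReal.coe_toNNReal_eq_toReal]

/-- At an integer `N` the cosine is `(-1) ^ N`, so this is the Poisson generating function at `-1`.
-/
theorem IsPoissonProcess.integral_cos_pi (hR : IsPoissonProcess P R c) {B : Set ℝ}
    (hB : MeasurableSet B) (hv : volume B ≠ ∞) :
    ∫ ω, Real.cos (Real.pi * (R ω B).toReal) ∂P = Real.exp (-2 * (c * (volume B).toReal)) := by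
  have hm : Measurable fun x : ℝ≥0∞ => Real.cos (Real.pi * x.toReal) :=
    Real.measurable_cos.comp (measurable_const.mul ENNReal.measurable_toReal)
  have hf : ∀ n : ℕ, Real.cos (Real.pi * (n : ℝ≥0∞).toReal) = (-1) ^ n := fun n => by
    rw [ENNReal.toReal_natCast, mul_comm, Real.cos_nat_mul_pi]
  calc ∫ ω, Real.cos (Real.pi * (R ω B).toReal) ∂P
      = ∫ x, Real.cos (Real.pi * x.toReal) ∂(P.map fun ω => R ω B) :=
        (integral_map (hR.measurable_apply hB).aemeasurable hm.aestronglyMeasurable).symm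
    _ = ∫ n : ℕ, (-1 : ℝ) ^ n ∂(poissonMeasure (c * (volume B).toNNReal)) := by
        rw [hR.law B hB hv,
          integral_map measurable_from_top.aemeasurable hm.aestronglyMeasurable]
        simp_rw [hf]
    _ = Real.exp (-2 * (c * (volume B).toReal)) := by
        rw [integral_poissonMeasure]
        set l : ℝ≥0 := c * (volume B).toNNReal
        have hl : (c : ℝ) * (volume B).toReal = l := by simp [l, ENNReal.coe_toNNReal_eq_toReal]
        have h := (NormedSpace.expSeries_div_hasSum_exp (-(l : ℝ))).mul_left (Real.exp (-l))
        rw [← Real.exp_eq_exp_ℝ, ← Real.exp_add] at h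
        rw [hl, show -2 * (l : ℝ) = -l + -l by ring, ← h.tsum_eq]
        refine tsum_congr fun n => ?_
        rw [smul_eq_mul, neg_pow (l : ℝ) n]
        ring

end Poisson

/-! ### Pairs that cross a point of the line -/

/-- The pairs whose endpoints are separated by the point `t`. -/
def crossing (t : ℝ) : Set (Sym2 ℝ) := {e | e.inf < t ∧ t ≤ e.sup}

theorem measurableSet_crossing (t : ℝ) : MeasurableSet (crossing t) :=
  (measurableSet_lt measurable_sym2_inf measurable_const).inter
    (measurableSet_le measurable_const measurable_sym2_sup)

theorem inf_map_addRight (t : ℝ) (e : Sym2 ℝ) :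
    (Sym2.map (IsometryEquiv.addRight t) e).inf = e.inf + t := by
  induction e with | _ a b
  simp [min_add_add_right]

theorem sup_map_addRight (t : ℝ) (e : Sym2 ℝ) :
    (Sym2.map (IsometryEquiv.addRight t) e).sup = e.sup + t := by
  induction e with | _ a b
  simp [max_add_add_right]

theorem measurable_map_addRight (t : ℝ) : Measurable (Sym2.map (IsometryEquiv.addRight t)) :=
  measurable_sym2_map (IsometryEquiv.addRight t).continuous.measurable

theorem map_crossing (t : ℝ) (m : Measure (Sym2 ℝ)) :
    m.map (Sym2.map (IsometryEquiv.addRight (-t))) (crossing 0) = m (crossing t) := by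
  rw [Measure.map_apply (measurable_map_addRight _) (measurableSet_crossing 0)]
  congr 1
  ext e
  simp only [crossing, Set.mem_preimage, Set.mem_ofPred_eq, inf_map_addRight, sup_map_addRight]
  constructor <;> rintro ⟨h1, h2⟩ <;> constructor <;> linarith

/-- The parity identity for a single pair. The doubled terms, for pairs inside `[s, t)` and pairs
that jump over it, are placed so that no subtraction in `ℝ≥0∞` occurs. -/
theorem crossing_indicator_add {s t : ℝ} (hst : s ≤ t) (e : Sym2 ℝ) :
    (crossing s).indicator (1 : Sym2 ℝ → ℝ≥0∞) e + (crossing t).indicator 1 e +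
        2 * {e : Sym2 ℝ | s ≤ e.inf ∧ e.sup < t}.indicator 1 e =
      endpoints (Set.Ico s t) Set.univ e +
        2 * {e : Sym2 ℝ | e.inf < s ∧ t ≤ e.sup}.indicator 1 e := by
  induction e with | _ a b
  wlog hab : a ≤ b generalizing a b
  · rw [Sym2.eq_swap]
    exact this b a (le_of_not_ge hab)
  rw [endpoints_mk]
  simp only [Set.indicator_apply, crossing, Set.mem_ofPred_eq, Sym2.inf_mk, Sym2.sup_mk,
    inf_eq_left.2 hab, sup_eq_right.2 hab, Set.mem_Ico, Set.mem_univ, if_true, mul_one,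
    Pi.one_apply]
  simp only [← not_lt]
  by_cases h1 : a < s <;> by_cases h2 : b < s <;> by_cases h3 : a < t <;> by_cases h4 : b < t <;>
    first
    | (exfalso; linarith)
    | simp [h1, h2, h3, h4, one_add_one_eq_two, -not_lt]

theorem cos_pi_mul_toReal_natCast (n : ℕ) :
    Real.cos (Real.pi * ((n : ℝ≥0∞)).toReal) = (-1) ^ n := by
  rw [ENNReal.toReal_natCast, mul_comm, Real.cos_nat_mul_pi]

theorem IsSimpleCounting.exists_natCast {E : Type*} [MeasurableSpace E] [TopologicalSpace E]
    [MeasurableSingletonClass E] {μ : Measure E} (h : IsSimpleCounting μ) {C : Set E}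
    (hC : MeasurableSet C) (hfin : μ C ≠ ∞) : ∃ n : ℕ, μ C = n := by
  rw [h.apply hC] at hfin ⊢
  obtain ⟨n, hn⟩ := ENat.ne_top_iff_exists.1
    (fun h' : (supp μ ∩ C).encard = ⊤ => hfin (by rw [h', ENat.toENNReal_top]))
  exact ⟨n, by rw [← hn]; simp⟩

theorem cos_crossing_mul {m : Measure (Sym2 ℝ)} {μ : Measure ℝ} (hm : IsSimpleCounting m)
    (hμ : IsSimpleCounting μ) {s t : ℝ} (hst : s ≤ t)
    (hμm : μ (Set.Ico s t) = ∫⁻ e, endpoints (Set.Ico s t) Set.univ e ∂m)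
    (hs : m (crossing s) ≠ ∞) (ht : m (crossing t) ≠ ∞) :
    Real.cos (Real.pi * (m (crossing s)).toReal) * Real.cos (Real.pi * (m (crossing t)).toReal) =
      Real.cos (Real.pi * (μ (Set.Ico s t)).toReal) := by
  have h1 : MeasurableSet {e : Sym2 ℝ | s ≤ e.inf ∧ e.sup < t} :=
    (measurableSet_le measurable_const measurable_sym2_inf).inter
      (measurableSet_lt measurable_sym2_sup measurable_const)
  have h2 : MeasurableSet {e : Sym2 ℝ | e.inf < s ∧ t ≤ e.sup} :=
    (measurableSet_lt measurable_sym2_inf measurable_const).inter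
      (measurableSet_le measurable_const measurable_sym2_sup)
  have hi : ∀ {C : Set (Sym2 ℝ)}, MeasurableSet C →
      Measurable (C.indicator (1 : Sym2 ℝ → ℝ≥0∞)) := fun hC => measurable_one.indicator hC
  have hint := lintegral_congr (μ := m) (crossing_indicator_add hst)
  rw [lintegral_add_right _ ((hi h1).const_mul 2),
    lintegral_add_right _ (hi (measurableSet_crossing t)),
    lintegral_add_right _ ((hi h2).const_mul 2), lintegral_const_mul _ (hi h1),
    lintegral_const_mul _ (hi h2), lintegral_indicator_one h1, lintegral_indicator_one h2,
    lintegral_indicator_one (measurableSet_crossing t),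
    lintegral_indicator_one (measurableSet_crossing s), ← hμm] at hint
  have := hμ.1
  have hμfin : μ (Set.Ico s t) ≠ ∞ :=
    measure_ne_top_of_subset Set.Ico_subset_Icc_self isCompact_Icc.measure_lt_top.ne
  have h2fin : m {e : Sym2 ℝ | e.inf < s ∧ t ≤ e.sup} ≠ ∞ :=
    measure_ne_top_of_subset
      (show _ ⊆ crossing s from fun e he => ⟨he.1, hst.trans he.2⟩) hs
  -- Finiteness is read off the integrated identity, whose other side is already known to be finite.
  have h1fin : m {e : Sym2 ℝ | s ≤ e.inf ∧ e.sup < t} ≠ ∞ := by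
    intro h
    rw [h] at hint
    have : μ (Set.Ico s t) + 2 * m {e : Sym2 ℝ | e.inf < s ∧ t ≤ e.sup} ≠ ∞ :=
      ENNReal.add_ne_top.2 ⟨hμfin, ENNReal.mul_ne_top (by simp) h2fin⟩
    exact this (by rw [← hint]; simp)
  obtain ⟨a, ha⟩ := hm.exists_natCast (measurableSet_crossing s) hs
  obtain ⟨b, hb⟩ := hm.exists_natCast (measurableSet_crossing t) ht
  obtain ⟨i, hi⟩ := hm.exists_natCast h1 h1fin
  obtain ⟨j, hj⟩ := hm.exists_natCast h2 h2fin
  obtain ⟨r, hr⟩ := hμ.exists_natCast measurableSet_Ico hμfin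
  rw [ha, hb, hi, hj, hr] at hint
  have hnat : a + b + 2 * i = r + 2 * j := by exact_mod_cast hint
  rw [ha, hb, hr, cos_pi_mul_toReal_natCast, cos_pi_mul_toReal_natCast, cos_pi_mul_toReal_natCast,
    ← pow_add]
  calc (-1 : ℝ) ^ (a + b) = (-1) ^ (a + b + 2 * i) := by rw [pow_add _ _ (2 * i), pow_mul]; simp
    _ = (-1) ^ r := by rw [hnat, pow_add, pow_mul]; simp

/-! ### The expected number of crossings -/

section Crossing

variable {Ω : Type*} [MeasurableSpace Ω] {P : Measure Ω} {R : Ω → Measure ℝ}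
  {M : Ω → Measure (Sym2 ℝ)}

/-- For `x ≥ 0` exactly `⌊x⌋ + 1 ≤ 1 + x` naturals `k` satisfy `k ≤ x`, and for `x < 0` none does.
-/
theorem tsum_measure_Ici_le (ν : Measure ℝ) [IsProbabilityMeasure ν] :
    ∑' k : ℕ, ν (Set.Ici (k : ℝ)) ≤ 1 + ∫⁻ x, ENNReal.ofReal x ∂ν := by
  have hm : ∀ k : ℕ, Measurable ((Set.Ici (k : ℝ)).indicator (1 : ℝ → ℝ≥0∞)) := fun k =>
    measurable_one.indicator measurableSet_Ici
  simp_rw [← fun k : ℕ => lintegral_indicator_one (μ := ν) (measurableSet_Ici (a := (k : ℝ)))]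
  rw [← lintegral_tsum fun k => (hm k).aemeasurable]
  calc ∫⁻ x, ∑' k : ℕ, (Set.Ici (k : ℝ)).indicator 1 x ∂ν
      ≤ ∫⁻ x, 1 + ENNReal.ofReal x ∂ν := by
        refine lintegral_mono fun x => ?_
        rcases lt_or_ge x 0 with hx | hx
        · have : ∀ k : ℕ, (Set.Ici (k : ℝ)).indicator (1 : ℝ → ℝ≥0∞) x = 0 := fun k =>
            Set.indicator_of_notMem (fun h => by
              have : (k : ℝ) ≤ x := h
              have := k.cast_nonneg (α := ℝ)
              linarith) _
          simp [this]
        · rw [tsum_eq_sum (s := Finset.range (⌊x⌋₊ + 1))]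
          · calc ∑ k ∈ Finset.range (⌊x⌋₊ + 1), (Set.Ici (k : ℝ)).indicator (1 : ℝ → ℝ≥0∞) x
                ≤ ∑ k ∈ Finset.range (⌊x⌋₊ + 1), 1 :=
                  Finset.sum_le_sum fun k _ => Set.indicator_le_self' (by simp) _
              _ = 1 + (⌊x⌋₊ : ℝ≥0∞) := by simp [add_comm]
              _ ≤ 1 + ENNReal.ofReal x := by
                  gcongr
                  rw [← ENNReal.ofReal_natCast]
                  exact ENNReal.ofReal_le_ofReal (Nat.floor_le hx)
          · intro k hk
            refine Set.indicator_of_notMem (fun h => hk ?_) _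
            simpa [Nat.lt_succ_iff] using Nat.le_floor h
    _ = 1 + ∫⁻ x, ENNReal.ofReal x ∂ν := by
        rw [lintegral_add_left measurable_const]; simp

/-- A pair that crosses `0` from `[-(k + 1), -k)`, translated by `k + 1`, starts in `[0, 1)` and has
length greater than `k`. Summing over `k` bounds the mean by a sum of tails of the distance. -/
theorem IsMatchingScheme.lintegral_crossing_le {ν : Measure ℝ} [IsProbabilityMeasure ν]
    (h : IsMatchingScheme P R M) (hRm : Measurable R) (hinv : IsTranslationInvariant P R M)
    (hν : ∀ B, MeasurableSet B → ν B =
      ∫⁻ ω, ((matchedAt (supp (R ω)) (supp (M ω)) (Set.Ico 0 1) B).encard : ℝ≥0∞) ∂P) :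
    ∫⁻ ω, M ω (crossing 0) ∂P ≤ 1 + ∫⁻ x, ENNReal.ofReal x ∂ν := by
  refine le_trans ?_ (tsum_measure_Ici_le ν)
  have hMm := h.measurable
  let D : ℕ → Set (Sym2 ℝ) := fun k => {e | e.inf ∈ Set.Ico (-(k + 1 : ℝ)) (-k) ∧ 0 ≤ e.sup}
  let D' : ℕ → Set (Sym2 ℝ) := fun k => {e | e.inf ∈ Set.Ico (0 : ℝ) 1 ∧ (k + 1 : ℝ) ≤ e.sup}
  have hD' : ∀ k, MeasurableSet (D' k) := fun k =>
    (measurable_sym2_inf measurableSet_Ico).inter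
      (measurableSet_le measurable_const measurable_sym2_sup)
  have hcover : crossing 0 ⊆ ⋃ k, D k := by
    rintro e ⟨h1, h2⟩
    -- The index is the `k` with `k < -e.inf ≤ k + 1`; the natural subtraction is harmless because
    -- `e.inf < 0`.
    refine Set.mem_iUnion.2 ⟨⌈-e.inf⌉₊ - 1, ⟨?_, ?_⟩, h2⟩
    all_goals
      have hpos : 0 < ⌈-e.inf⌉₊ := Nat.ceil_pos.2 (by linarith)
      have h3 := Nat.le_ceil (-e.inf)
      have h4 := Nat.ceil_lt_add_one (a := -e.inf) (by linarith)
      rw [Nat.cast_sub (by omega), Nat.cast_one]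
      linarith
  have hshift : ∀ k : ℕ, ∫⁻ ω, M ω (D k) ∂P = ∫⁻ ω, M ω (D' k) ∂P := by
    intro k
    have hτ := measurable_map_addRight (k + 1 : ℝ)
    have h1 : ∀ ω, M ω (D k) =
        (M ω).map (Sym2.map (IsometryEquiv.addRight (k + 1 : ℝ))) (D' k) := fun ω => by
      rw [Measure.map_apply hτ (hD' k)]
      congr 1
      ext e
      simp only [D, D', Set.mem_preimage, Set.mem_ofPred_eq, inf_map_addRight, sup_map_addRight,
        Set.mem_Ico]
      constructor <;> rintro ⟨⟨h1, h2⟩, h3⟩ <;> refine ⟨⟨?_, ?_⟩, ?_⟩ <;> linarith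
    have hF : Measurable fun p : Measure ℝ × Measure (Sym2 ℝ) => p.2 (D' k) :=
      (Measure.measurable_coe (hD' k)).comp measurable_snd
    have h2 : Measurable fun ω => ((R ω).map (IsometryEquiv.addRight (k + 1 : ℝ)),
        (M ω).map (Sym2.map (IsometryEquiv.addRight (k + 1 : ℝ)))) :=
      ((Measure.measurable_map _ (IsometryEquiv.addRight (k + 1 : ℝ)).continuous.measurable).comp
        hRm).prodMk ((Measure.measurable_map _ hτ).comp hMm)
    simp_rw [h1]
    rw [← lintegral_map hF h2, hinv (k + 1), lintegral_map hF (hRm.prodMk hMm)]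
  calc ∫⁻ ω, M ω (crossing 0) ∂P ≤ ∫⁻ ω, ∑' k, M ω (D k) ∂P :=
        lintegral_mono fun ω => (measure_mono hcover).trans (measure_iUnion_le _)
    _ = ∑' k, ∫⁻ ω, M ω (D k) ∂P := by
        refine lintegral_tsum fun k => (?_ : Measurable fun ω => M ω (D k)).aemeasurable
        exact (Measure.measurable_coe ((measurable_sym2_inf measurableSet_Ico).inter
          (measurableSet_le measurable_const measurable_sym2_sup))).comp hMm
    _ = ∑' k, ∫⁻ ω, M ω (D' k) ∂P := by simp_rw [hshift]
    _ ≤ ∑' k : ℕ, ν (Set.Ici (k : ℝ)) := by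
        refine ENNReal.tsum_le_tsum fun k => ?_
        rw [hν _ measurableSet_Ici]
        refine lintegral_mono_ae ?_
        filter_upwards [h.ae_encard (Set.Ico 0 1) (Set.Ici (k : ℝ))] with ω hω
        rw [hω, ← lintegral_indicator_one (hD' k)]
        refine lintegral_mono fun e => ?_
        induction e with | _ a b
        by_cases he : s(a, b) ∈ D' k
        · rw [Set.indicator_of_mem he, endpoints_mk]
          obtain ⟨h1, h2⟩ := he
          simp only [Sym2.inf_mk, Sym2.sup_mk] at h1 h2
          rcases le_total a b with hab | hab
          · rw [inf_eq_left.2 hab] at h1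
            rw [sup_eq_right.2 hab] at h2
            have h3 : |a - b| ∈ Set.Ici (k : ℝ) := by
              rw [Set.mem_Ici, abs_sub_comm, abs_of_nonneg (by linarith)]
              linarith [h1.2]
            simp [-Set.mem_Ico, -Set.mem_Ici, h1, h3]
          · rw [inf_eq_right.2 hab] at h1
            rw [sup_eq_left.2 hab] at h2
            have h3 : |b - a| ∈ Set.Ici (k : ℝ) := by
              rw [Set.mem_Ici, abs_sub_comm, abs_of_nonneg (by linarith)]
              linarith [h1.2]
            simp [-Set.mem_Ico, -Set.mem_Ici, h1, h3]
        · rw [Set.indicator_of_notMem he]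
          exact bot_le

end Crossing

/-! ### Local approximation of functions of a configuration -/

theorem measurable_restrict {s : Set ℝ} (hs : MeasurableSet s) :
    Measurable fun μ : Measure ℝ => μ.restrict s :=
  Measure.measurable_of_measurable_coe _ fun C hC => by
    simp_rw [Measure.restrict_apply hC]
    exact Measure.measurable_coe (hC.inter hs)

/-- A bounded function of a random measure is approximated in mean by functions of its restriction
to a bounded interval. -/
theorem exists_local_approx (Q : Measure (Measure ℝ)) [IsProbabilityMeasure Q]
    {φ : Measure ℝ → ℝ} (hφ : Measurable φ) (hb : ∀ μ, |φ μ| ≤ 1) {ε : ℝ} (hε : 0 < ε) :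
    ∃ (n : ℕ) (z : Measure ℝ → ℝ), Measurable z ∧ (∀ μ, |z μ| ≤ 1) ∧
      ∫ μ, |z (μ.restrict (Set.Ico (-n : ℝ) n)) - φ μ| ∂Q ≤ ε := by
  let I : ℕ → Set ℝ := fun n => Set.Ico (-n : ℝ) n
  have hI : ∀ n, MeasurableSet (I n) := fun n => measurableSet_Ico
  have hImono : Monotone I := fun n m hnm => by
    have : (n : ℝ) ≤ m := by exact_mod_cast hnm
    exact Set.Ico_subset_Ico (by linarith) this
  have hr : ∀ n, Measurable fun μ : Measure ℝ => μ.restrict (I n) := fun n =>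
    measurable_restrict (hI n)
  let ℱ : Filtration ℕ (Measure.instMeasurableSpace : MeasurableSpace (Measure ℝ)) :=
    { seq := fun n => MeasurableSpace.comap (fun μ : Measure ℝ => μ.restrict (I n)) inferInstance
      mono' := fun n m hnm => by
        have : (fun μ : Measure ℝ => μ.restrict (I n)) =
            (fun μ : Measure ℝ => μ.restrict (I n)) ∘ fun μ : Measure ℝ => μ.restrict (I m) := by
          funext μ
          simp [Measure.restrict_restrict (hI n),
            Set.inter_eq_self_of_subset_left (hImono hnm)]
        change MeasurableSpace.comap _ _ ≤ MeasurableSpace.comap _ _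
        rw [this, ← MeasurableSpace.comap_comp]
        exact MeasurableSpace.comap_mono (hr n).comap_le
      le' := fun n => (hr n).comap_le }
  have hsup : ⨆ n, ℱ n = (Measure.instMeasurableSpace : MeasurableSpace (Measure ℝ)) := by
    refine le_antisymm (iSup_le fun n => ℱ.le n) ?_
    refine iSup_le fun s => iSup_le fun hs => ?_
    rw [← BorelSpace.measurable_eq]
    refine Measurable.comap_le ?_
    have h1 : (fun μ : Measure ℝ => μ s) = fun μ => ⨆ n : ℕ, (μ.restrict (I n)) s := by
      funext μ
      have hU : s = ⋃ n : ℕ, s ∩ I n := by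
        rw [← Set.inter_iUnion]
        refine (Set.inter_eq_self_of_subset_left fun x _ => ?_).symm
        obtain ⟨n, hn⟩ := exists_nat_gt |x|
        have := abs_lt.1 hn
        exact Set.mem_iUnion.2 ⟨n, this.1.le, this.2⟩
      simp_rw [Measure.restrict_apply hs]
      conv_lhs => rw [hU]
      exact Monotone.measure_iUnion fun n m hnm => Set.inter_subset_inter_right _ (hImono hnm)
    rw [h1]
    refine Measurable.iSup fun n => ?_
    have h2 : Measurable[ℱ n] fun μ : Measure ℝ => (μ.restrict (I n)) s :=
      (Measure.measurable_coe hs).comp (comap_measurable _)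
    exact h2.mono (le_iSup (fun n => (ℱ n : MeasurableSpace (Measure ℝ))) n) le_rfl
  have hφint : Integrable φ Q :=
    Integrable.of_bound hφ.aestronglyMeasurable 1 (Filter.Eventually.of_forall fun μ => hb μ)
  -- Lévy's upward theorem: the conditional expectations given larger and larger windows converge to
  -- `φ` in mean.
  have hlim := hφint.tendsto_eLpNorm_condExp (ℱ := ℱ) (by rw [hsup]; exact hφ.stronglyMeasurable)
  obtain ⟨n, hn⟩ := (hlim.eventually (gt_mem_nhds (ENNReal.ofReal_pos.2 hε))).exists
  obtain ⟨z, hz, hzeq⟩ := (stronglyMeasurable_condExp (m := ℱ n) (f := φ)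
    (μ := Q)).measurable.exists_eq_measurable_comp
  -- Truncation to `[-1, 1]` brings the approximation no farther from `φ` and makes it bounded
  -- everywhere, not just almost surely.
  have hclamp : ∀ x y : ℝ, |y| ≤ 1 → |max (-1) (min 1 x) - y| ≤ |x - y| := by
    intro x y hy
    obtain ⟨h1, h2⟩ := abs_le.1 hy
    rcases le_total 1 x with h | h
    · rw [min_eq_left h, max_eq_right (by norm_num), abs_of_nonneg (by linarith),
        abs_of_nonneg (by linarith)]
      linarith
    · rw [min_eq_right h]
      rcases le_total (-1) x with h' | h'
      · rw [max_eq_right h']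
      · rw [max_eq_left h', abs_of_nonpos (by linarith), abs_of_nonpos (by linarith)]
        linarith
  refine ⟨n, fun μ => max (-1) (min 1 (z μ)), measurable_const.max (measurable_const.min hz),
    fun μ => abs_le.2 ⟨le_max_left _ _, max_le (by norm_num) (min_le_left _ _)⟩, ?_⟩
  have hint : Integrable (fun μ => Q[φ|ℱ n] μ - φ μ) Q := integrable_condExp.sub hφint
  calc ∫ μ, |max (-1) (min 1 (z (μ.restrict (I n)))) - φ μ| ∂Q
      ≤ ∫ μ, |Q[φ|ℱ n] μ - φ μ| ∂Q := by
        refine integral_mono_of_nonneg (Filter.Eventually.of_forall fun μ => abs_nonneg _)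
          hint.abs (Filter.Eventually.of_forall fun μ => ?_)
        dsimp only
        rw [hzeq]
        exact hclamp _ _ (hb μ)
    _ ≤ ε := by
        have h1 : ∫ μ, |Q[φ|ℱ n] μ - φ μ| ∂Q = (eLpNorm (Q[φ|ℱ n] - φ) 1 Q).toReal := by
          rw [eLpNorm_one_eq_lintegral_enorm]
          exact integral_norm_eq_lintegral_enorm hint.aestronglyMeasurable
        rw [h1]
        exact ENNReal.toReal_le_of_le_ofReal hε.le hn.le

/-! ### A factor cannot have finite mean typical distance -/

section Factor

variable {Ω : Type*} [MeasurableSpace Ω] {P : Measure Ω} {R : Ω → Measure ℝ}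
  {M : Ω → Measure (Sym2 ℝ)}

/-- The sign `(-1) ^ N`, for a number of points `N`. -/
noncomputable def sign (x : ℝ≥0∞) : ℝ := Real.cos (Real.pi * x.toReal)

theorem measurable_sign : Measurable sign :=
  Real.measurable_cos.comp (measurable_const.mul ENNReal.measurable_toReal)

theorem abs_sign_le_one (x : ℝ≥0∞) : |sign x| ≤ 1 := Real.abs_cos_le_one _

theorem sign_natCast (n : ℕ) : sign n = (-1) ^ n := cos_pi_mul_toReal_natCast n

theorem sign_union {μ : Measure ℝ} (hμ : IsSimpleCounting μ) {a b c : ℝ} (hab : a ≤ b)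
    (hbc : b ≤ c) : sign (μ (Set.Ico a c)) = sign (μ (Set.Ico a b)) * sign (μ (Set.Ico b c)) := by
  have := hμ.1
  have hfin : ∀ x y : ℝ, μ (Set.Ico x y) ≠ ∞ := fun x y =>
    measure_ne_top_of_subset Set.Ico_subset_Icc_self isCompact_Icc.measure_lt_top.ne
  obtain ⟨m, hm⟩ := hμ.exists_natCast measurableSet_Ico (hfin a b)
  obtain ⟨n, hn⟩ := hμ.exists_natCast measurableSet_Ico (hfin b c)
  have : μ (Set.Ico a c) = ((m + n : ℕ) : ℝ≥0∞) := by
    rw [← Set.Ico_union_Ico_eq_Ico hab hbc, measure_union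
      (Set.disjoint_left.2 fun x hx hx' => hx.2.not_ge hx'.1) measurableSet_Ico, hm, hn]
    simp
  rw [this, hm, hn, sign_natCast, sign_natCast, sign_natCast, pow_add]

/-- The signs of the configuration on long intervals cannot be a product of two signs that are
approximated by local functions. -/
theorem IsPoissonProcess.not_sign_eq_mul [IsProbabilityMeasure P] (hR : IsPoissonProcess P R 1)
    {φ : Measure ℝ → ℝ} (hφ : Measurable φ) (hb : ∀ μ, |φ μ| ≤ 1)
    (h : ∀ t : ℝ, 0 ≤ t → ∀ᵐ ω ∂P, φ (R ω) * φ ((R ω).map (IsometryEquiv.addRight (-t))) =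
      sign (R ω (Set.Ico 0 t))) : False := by
  have hRm := hR.measurable
  have : IsProbabilityMeasure (P.map R) := Measure.isProbabilityMeasure_map hRm.aemeasurable
  -- Two errors of `1 / 8` leave a correlation of at least `3 / 4`, against an upper bound of `exp
  -- (-2) ≤ 1 / 3`.
  obtain ⟨n, z, hz, hzb, hzφ⟩ := exists_local_approx (P.map R) hφ hb (ε := 1 / 8) (by norm_num)
  let I : Set ℝ := Set.Ico (-n : ℝ) n
  have hI : MeasurableSet I := measurableSet_Ico
  -- The translate of the window `[-n, n)` is `[n + 1, 3n + 1)`, which leaves a gap of length one.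
  let T : ℝ := 2 * n + 1
  have hn0 : (0 : ℝ) ≤ n := n.cast_nonneg
  let τ := IsometryEquiv.addRight (-T)
  have hτ : Measurable τ := τ.continuous.measurable
  have hres : Measurable fun μ : Measure ℝ => μ.restrict I := measurable_restrict hI
  have hmap : Measurable fun μ : Measure ℝ => μ.map τ := Measure.measurable_map _ hτ
  let X : Ω → ℝ := fun ω => φ (R ω)
  let X' : Ω → ℝ := fun ω => φ ((R ω).map τ)
  let Z : Ω → ℝ := fun ω => z ((R ω).restrict I)
  let Z' : Ω → ℝ := fun ω => z (((R ω).map τ).restrict I)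
  let S : Ω → ℝ := fun ω => sign (R ω (Set.Ico 0 T))
  have hX : Measurable X := hφ.comp hRm
  have hX' : Measurable X' := hφ.comp (hmap.comp hRm)
  have hZ : Measurable Z := hz.comp (hres.comp hRm)
  have hZ' : Measurable Z' := hz.comp (hres.comp (hmap.comp hRm))
  have hS : Measurable S := measurable_sign.comp (hR.measurable_apply measurableSet_Ico)
  have hD : Measurable fun μ : Measure ℝ => |z (μ.restrict I) - φ μ| :=
    ((hz.comp hres).sub hφ).abs
  have hZX : ∫ ω, |Z ω - X ω| ∂P ≤ 1 / 8 := by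
    rwa [integral_map hRm.aemeasurable hD.aestronglyMeasurable] at hzφ
  have hZX' : ∫ ω, |Z' ω - X' ω| ∂P ≤ 1 / 8 := by
    rw [← (hR.map_isometry τ).map_eq hR, integral_map (φ := fun ω => (R ω).map τ)
      (hmap.comp hRm).aemeasurable hD.aestronglyMeasurable] at hzφ
    exact hzφ
  have hbd : ∀ {f : Ω → ℝ}, Measurable f → (∀ ω, |f ω| ≤ 2) → Integrable f P := fun hf hf1 =>
    Integrable.of_bound hf.aestronglyMeasurable 2 (Filter.Eventually.of_forall hf1)
  have hsub : ∀ {a b : ℝ}, |a| ≤ 1 → |b| ≤ 1 → |a - b| ≤ 2 := fun ha hb =>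
    (abs_sub _ _).trans (by linarith)
  have hmul : ∀ {a b : ℝ}, |a| ≤ 1 → |b| ≤ 1 → |a * b| ≤ 1 := fun ha hb => by
    rw [abs_mul]; exact mul_le_one₀ ha (abs_nonneg _) hb
  have hSS : ∀ᵐ ω ∂P, S ω * S ω = 1 := by
    filter_upwards [hR.isSimplePointProcess.simple] with ω hω
    have := hω.1
    obtain ⟨m, hm⟩ := hω.exists_natCast (measurableSet_Ico (a := (0 : ℝ)) (b := T))
      (measure_ne_top_of_subset Set.Ico_subset_Icc_self isCompact_Icc.measure_lt_top.ne)
    simp only [S, hm, sign_natCast]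
    rw [← mul_pow]
    simp
  -- the lower bound
  have hlow : 3 / 4 ≤ ∫ ω, Z ω * Z' ω * S ω ∂P := by
    have h1 : ∀ᵐ ω ∂P, 1 - (|Z ω - X ω| + |Z' ω - X' ω|) ≤ Z ω * Z' ω * S ω := by
      filter_upwards [hSS, h T (by positivity)] with ω h1 h2
      have h3 : X ω * X' ω = S ω := h2
      -- Replace `Z` by `X`, then `Z'` by `X'`; what remains is `X * X' * S = S * S = 1`.
      have h4 : Z ω * Z' ω * S ω = 1 + ((Z ω - X ω) * (Z' ω * S ω) +
          (Z' ω - X' ω) * (X ω * S ω)) := by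
        rw [← h1]; nth_rw 2 [← h3]; ring
      have h5 := neg_abs_le ((Z ω - X ω) * (Z' ω * S ω))
      have h6 := neg_abs_le ((Z' ω - X' ω) * (X ω * S ω))
      rw [abs_mul] at h5 h6
      have h7 : |Z ω - X ω| * |Z' ω * S ω| ≤ |Z ω - X ω| :=
        mul_le_of_le_one_right (abs_nonneg _) (hmul (hzb _) (abs_sign_le_one _))
      have h8 : |Z' ω - X' ω| * |X ω * S ω| ≤ |Z' ω - X' ω| :=
        mul_le_of_le_one_right (abs_nonneg _) (hmul (hb _) (abs_sign_le_one _))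
      linarith
    have hi1 : Integrable (fun ω => |Z ω - X ω|) P :=
      (hbd (hZ.sub hX) fun ω => hsub (hzb _) (hb _)).abs
    have hi2 : Integrable (fun ω => |Z' ω - X' ω|) P :=
      (hbd (hZ'.sub hX') fun ω => hsub (hzb _) (hb _)).abs
    have hi : Integrable (fun ω => |Z ω - X ω| + |Z' ω - X' ω|) P := hi1.add hi2
    have hi3 : Integrable (fun ω => Z ω * Z' ω * S ω) P :=
      hbd ((hZ.mul hZ').mul hS) fun ω =>
        (hmul (hmul (hzb _) (hzb _)) (abs_sign_le_one _)).trans one_le_two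
    calc (3 / 4 : ℝ) ≤ ∫ ω, (1 - (|Z ω - X ω| + |Z' ω - X' ω|)) ∂P := by
          rw [integral_sub (integrable_const _) hi, integral_add hi1 hi2]
          simp
          linarith
      _ ≤ _ := integral_mono_ae ((integrable_const _).sub hi) hi3 h1
  -- the upper bound
  let A : Set ℝ := (Set.Ico (n : ℝ) (n + 1))ᶜ
  have hA : MeasurableSet A := measurableSet_Ico.compl
  -- All factors of the product except the sign of the gap; they see only the points outside the
  -- gap.
  let w : Measure ℝ → ℝ := fun μ => z (μ.restrict I) * z ((μ.map τ).restrict I) *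
    (sign (μ (Set.Ico 0 n)) * sign (μ (Set.Ico (n + 1 : ℝ) T)))
  have hw : Measurable w := ((hz.comp hres).mul (hz.comp (hres.comp hmap))).mul
    ((measurable_sign.comp (Measure.measurable_coe measurableSet_Ico)).mul
      (measurable_sign.comp (Measure.measurable_coe measurableSet_Ico)))
  have hwb : ∀ μ, |w μ| ≤ 1 := fun μ => hmul (hmul (hzb _) (hzb _))
    (hmul (abs_sign_le_one _) (abs_sign_le_one _))
  have hIA : I ⊆ A := fun x hx hx' => hx.2.not_ge hx'.1
  have hIA' : τ ⁻¹' I ⊆ A := fun x hx hx' => by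
    have h1 : -(n : ℝ) ≤ x + -T := hx.1
    have h2 : x < n + 1 := hx'.2
    simp only [T] at h1
    linarith
  have hwA : ∀ μ : Measure ℝ, w (μ.restrict A) = w μ := by
    intro μ
    have h1 : (μ.restrict A).restrict I = μ.restrict I := by
      rw [Measure.restrict_restrict hI, Set.inter_eq_self_of_subset_left hIA]
    have h2 : ((μ.restrict A).map τ).restrict I = (μ.map τ).restrict I := by
      rw [Measure.restrict_map hτ hI, Measure.restrict_map hτ hI,
        Measure.restrict_restrict (hτ hI), Set.inter_eq_self_of_subset_left hIA']
    have h3 : (μ.restrict A) (Set.Ico 0 n) = μ (Set.Ico 0 n) := by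
      rw [Measure.restrict_apply measurableSet_Ico, Set.inter_eq_self_of_subset_left]
      exact fun x hx hx' => hx.2.not_ge hx'.1
    have h4 : (μ.restrict A) (Set.Ico (n + 1 : ℝ) T) = μ (Set.Ico (n + 1 : ℝ) T) := by
      rw [Measure.restrict_apply measurableSet_Ico, Set.inter_eq_self_of_subset_left]
      exact fun x hx hx' => hx.1.not_gt hx'.2
    simp only [w, h1, h2, h3, h4]
  have hind : IndepFun (fun ω => w (R ω)) (fun ω => sign (R ω (Set.Ico (n : ℝ) (n + 1)))) P := by
    have := (hR.indepFun_restrict hA (measurableSet_Ico (a := (n : ℝ)) (b := n + 1))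
      disjoint_compl_left).comp hw measurable_sign
    refine this.congr (Filter.Eventually.of_forall fun ω => hwA _)
      (Filter.Eventually.of_forall fun ω => rfl)
  have hprod : ∫ ω, Z ω * Z' ω * S ω ∂P =
      (∫ ω, w (R ω) ∂P) * Real.exp (-2) := by
    have h1 : ∫ ω, sign (R ω (Set.Ico (n : ℝ) (n + 1))) ∂P = Real.exp (-2) := by
      have := hR.integral_cos_pi (measurableSet_Ico (a := (n : ℝ)) (b := n + 1)) (by simp)
      simpa [sign] using this
    rw [← h1, ← hind.integral_fun_mul_eq_mul_integral (hw.comp hRm).aestronglyMeasurable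
      (measurable_sign.comp (hR.measurable_apply measurableSet_Ico)).aestronglyMeasurable]
    refine integral_congr_ae ?_
    filter_upwards [hR.isSimplePointProcess.simple] with ω hω
    simp only [Z, Z', S, w]
    rw [sign_union hω (b := n) hn0 (by simp only [T]; linarith),
      sign_union hω (a := n) (b := n + 1) (by linarith) (by simp only [T]; linarith)]
    ring
  have hwle : ∫ ω, w (R ω) ∂P ≤ 1 := by
    calc ∫ ω, w (R ω) ∂P ≤ ∫ _, (1 : ℝ) ∂P := integral_mono
          (hbd (hw.comp hRm) fun ω => (hwb _).trans (by norm_num)) (integrable_const _)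
          fun ω => (le_abs_self _).trans (hwb _)
      _ = 1 := by simp
  have hexp : Real.exp (-2) ≤ 1 / 3 := by
    rw [Real.exp_neg, ← one_div]
    exact one_div_le_one_div_of_le (by norm_num) (by linarith [Real.add_one_le_exp (2 : ℝ)])
  rw [hprod] at hlow
  nlinarith [Real.exp_pos (-2)]

/-- The function `f` need not commute with translations. That `φ` also gives the crossing sign of
the translated pair of processes comes from invariance of the joint law, applied to the measurable
event `G`. -/
theorem IsMatchingScheme.lintegral_eq_top_of_isFactor [IsProbabilityMeasure P]
    (hR : IsPoissonProcess P R 1) (h : IsMatchingScheme P R M)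
    (hinv : IsTranslationInvariant P R M) (hfac : IsFactor P R M)
    {ν : Measure ℝ} [IsProbabilityMeasure ν] (hν : ∀ B, MeasurableSet B → ν B =
      ∫⁻ ω, ((matchedAt (supp (R ω)) (supp (M ω)) (Set.Ico 0 1) B).encard : ℝ≥0∞) ∂P) :
    ∫⁻ x, ENNReal.ofReal x ∂ν = ∞ := by
  by_contra hne
  have hRm := hR.measurable
  have hMm := h.measurable
  have hfin : ∀ᵐ ω ∂P, M ω (crossing 0) < ∞ :=
    ae_lt_top ((Measure.measurable_coe (measurableSet_crossing 0)).comp hMm)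
      ((h.lintegral_crossing_le hRm hinv hν).trans_lt
        (ENNReal.add_lt_top.2 ⟨ENNReal.one_lt_top, lt_top_iff_ne_top.2 hne⟩)).ne
  obtain ⟨f, hf, hfM⟩ := hfac
  have hcr := Measure.measurable_coe (measurableSet_crossing 0)
  let φ : Measure ℝ → ℝ := fun μ => sign (f μ (crossing 0))
  have hφ : Measurable φ := measurable_sign.comp (hcr.comp hf)
  let G : Set (Measure ℝ × Measure (Sym2 ℝ)) :=
    {p | φ p.1 = sign (p.2 (crossing 0)) ∧ p.2 (crossing 0) < ∞}
  have hG : MeasurableSet G :=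
    (measurableSet_eq_fun (hφ.comp measurable_fst)
      (measurable_sign.comp (hcr.comp measurable_snd))).inter
      (measurableSet_lt (hcr.comp measurable_snd) measurable_const)
  have h0 : ∀ᵐ ω ∂P, (R ω, M ω) ∈ G := by
    filter_upwards [hfin, hfM] with ω h1 h2
    exact ⟨by simp only [φ]; rw [← h2], h1⟩
  refine hR.not_sign_eq_mul hφ (fun μ => abs_sign_le_one _) fun t ht => ?_
  have ht' : ∀ᵐ ω ∂P, ((R ω).map (IsometryEquiv.addRight (-t)),
      (M ω).map (Sym2.map (IsometryEquiv.addRight (-t)))) ∈ G := by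
    have h1 : ∀ᵐ p ∂(P.map fun ω => (R ω, M ω)), p ∈ G :=
      (ae_map_iff (hRm.prodMk hMm).aemeasurable hG).2 h0
    rw [← hinv (-t)] at h1
    exact (ae_map_iff (((Measure.measurable_map _
      (IsometryEquiv.addRight (-t)).continuous.measurable).comp hRm).prodMk
        ((Measure.measurable_map _ (measurable_map_addRight (-t))).comp hMm)).aemeasurable hG).1 h1
  filter_upwards [h0, ht', h.ae_isSimpleCounting, hR.isSimplePointProcess.simple,
    h.ae_apply hR.isSimplePointProcess (measurableSet_Ico (a := (0 : ℝ)) (b := t))]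
    with ω h1 h2 h3 h4 h5
  obtain ⟨h1, h1'⟩ := h1
  obtain ⟨h2, h2'⟩ := h2
  simp only [map_crossing] at h1 h2 h2'
  rw [h1, h2]
  exact cos_crossing_mul h3 h4 ht h5 h1'.ne h2'.ne

end Factor

/-! ### Enumeration of a configuration of points -/

/-- The number of points in `[0, q]`, minus the number of points in `(q, 0)`. -/
noncomputable def cumul (μ : Measure ℝ) (q : ℝ) : ℝ :=
  (μ (Set.Icc 0 q)).toReal - (μ (Set.Ioo q 0)).toReal

/-- The `k`-th point of a configuration, where the first point is the first one in `[0, ∞)`. -/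
noncomputable def point (μ : Measure ℝ) (k : ℤ) : ℝ :=
  (⨅ q : ℚ, if (k : ℝ) ≤ cumul μ q then ((q : ℝ) : EReal) else ⊤).toReal

theorem measurable_cumul (q : ℝ) : Measurable fun μ => cumul μ q :=
  (Measure.measurable_coe measurableSet_Icc).ennreal_toReal.sub
    (Measure.measurable_coe measurableSet_Ioo).ennreal_toReal

/-- The enumeration is defined as a countable infimum, over rational positions, precisely so that
its measurability is immediate. -/
theorem measurable_point (k : ℤ) : Measurable fun μ => point μ k := by
  refine Measurable.ereal_toReal (Measurable.iInf fun q => ?_)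
  exact Measurable.ite (measurableSet_le measurable_const (measurable_cumul q))
    measurable_const measurable_const

/-- A simple configuration of points, unbounded on both sides. -/
structure IsBiinfinite (μ : Measure ℝ) : Prop where
  isSimpleCounting : IsSimpleCounting μ
  exists_gt : ∀ a, ∃ x ∈ supp μ, a < x
  exists_lt : ∀ a, ∃ x ∈ supp μ, x < a

theorem IsSimpleCounting.finite_inter_Icc {μ : Measure ℝ} (h : IsSimpleCounting μ) (a b : ℝ) :
    (supp μ ∩ Set.Icc a b).Finite := by
  have := h.1
  have h1 : μ (Set.Icc a b) ≠ ∞ := isCompact_Icc.measure_lt_top.ne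
  rw [h.apply measurableSet_Icc] at h1
  by_contra hinf
  exact h1 (by rw [Set.encard_eq_top hinf, ENat.toENNReal_top])

theorem IsSimpleCounting.apply_eq_zero_iff {μ : Measure ℝ} (h : IsSimpleCounting μ) {C : Set ℝ}
    (hC : MeasurableSet C) : μ C = 0 ↔ ∀ x ∈ supp μ, x ∉ C := by
  rw [h.apply hC, ENat.toENNReal_eq_zero, Set.encard_eq_zero, ← Set.disjoint_iff_inter_eq_empty,
    Set.disjoint_left]

/-- The support is a locally finite linear order without endpoints, hence order isomorphic to `ℤ`.
-/
theorem IsBiinfinite.exists_strictMono {μ : Measure ℝ} (h : IsBiinfinite μ) :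
    ∃ y : ℤ → ℝ, StrictMono y ∧ Set.range y = supp μ := by
  classical
  let ι := supp μ
  have hfin : ∀ a b : ι, (Set.Icc a b).Finite := fun a b =>
    Set.Finite.of_finite_image (f := Subtype.val)
      ((h.isSimpleCounting.finite_inter_Icc a b).subset (by
        rintro _ ⟨x, hx, rfl⟩
        exact ⟨x.2, hx.1, hx.2⟩)) Subtype.val_injective.injOn
  let _ : LocallyFiniteOrder ι := LocallyFiniteOrder.ofFiniteIcc hfin
  let _ : SuccOrder ι := LinearLocallyFiniteOrder.succOrder ι
  let _ : PredOrder ι := LinearLocallyFiniteOrder.predOrder ι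
  have : NoMaxOrder ι := ⟨fun a => by
    obtain ⟨x, hx, hax⟩ := h.exists_gt a
    exact ⟨⟨x, hx⟩, hax⟩⟩
  have : NoMinOrder ι := ⟨fun a => by
    obtain ⟨x, hx, hax⟩ := h.exists_lt a
    exact ⟨⟨x, hx⟩, hax⟩⟩
  have : Nonempty ι := by
    obtain ⟨x, hx, -⟩ := h.exists_gt 0
    exact ⟨⟨x, hx⟩⟩
  let e : ι ≃o ℤ := orderIsoIntOfLinearSuccPredArch
  refine ⟨fun k => e.symm k, fun a b hab => e.symm.strictMono hab, ?_⟩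
  change Set.range (Subtype.val ∘ e.symm) = _
  rw [Set.range_comp, e.symm.range_eq]
  simp [ι]

theorem IsBiinfinite.exists_le_lt {μ : Measure ℝ} (h : IsBiinfinite μ) {y : ℤ → ℝ}
    (hy : StrictMono y) (hr : Set.range y = supp μ) (q : ℝ) : ∃ n, y n ≤ q ∧ q < y (n + 1) := by
  obtain ⟨x, hx, hqx⟩ := h.exists_gt q
  obtain ⟨x', hx', hqx'⟩ := h.exists_lt q
  rw [← hr] at hx hx'
  obtain ⟨i, rfl⟩ := hx
  obtain ⟨j, rfl⟩ := hx'
  obtain ⟨n, hn, hmax⟩ := Int.exists_greatest_of_bdd (P := fun n => y n ≤ q)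
    ⟨i, fun z hz => (hy.lt_iff_lt.1 (lt_of_le_of_lt hz hqx)).le⟩ ⟨j, hqx'.le⟩
  refine ⟨n, hn, lt_of_not_ge fun hle => ?_⟩
  have := hmax _ hle
  omega

/-- Two enumerations differ by an order automorphism of `ℤ`, which commutes with the successor and
so is a translation. -/
theorem strictMono_range_eq {y y' : ℤ → ℝ} (hy : StrictMono y) (hy' : StrictMono y')
    (h : Set.range y = Set.range y') : ∃ m : ℤ, ∀ k, y' k = y (k + m) := by
  let e : ℤ ≃o ℤ := ((StrictMono.orderIso y' hy').trans (OrderIso.setCongr _ _ h.symm)).trans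
    (StrictMono.orderIso y hy).symm
  have he : ∀ k, y (e k) = y' k := fun k => by
    have : StrictMono.orderIso y hy (e k) =
        OrderIso.setCongr _ _ h.symm (StrictMono.orderIso y' hy' k) := by simp [e]
    exact congrArg Subtype.val this
  have hs : ∀ k, e (k + 1) = e k + 1 := fun k => e.map_succ k
  have hk : ∀ k, e k = k + e 0 := by
    intro k
    induction k with
    | zero => simp
    | succ i ih => rw [hs, ih]; ring
    | pred i ih =>
      have := hs (-(i : ℤ) - 1)
      rw [sub_add_cancel, ih] at this
      linarith
  exact ⟨e 0, fun k => by rw [← hk, he]⟩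

theorem IsBiinfinite.le_cumul_iff {μ : Measure ℝ} (h : IsBiinfinite μ) {y : ℤ → ℝ}
    (hy : StrictMono y) (hr : Set.range y = supp μ) (h0 : y 0 < 0) (h1 : 0 ≤ y 1) (k : ℤ) (q : ℝ) :
    (k : ℝ) ≤ cumul μ q ↔ y k ≤ q := by
  obtain ⟨n, hn, hn'⟩ := h.exists_le_lt hy hr q
  have hcard : ∀ {C : Set ℝ} (a b : ℤ), MeasurableSet C → (∀ k, y k ∈ C ↔ k ∈ Set.Icc a b) →
      (μ C).toReal = ((b + 1 - a).toNat : ℝ) := by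
    intro C a b hC hab
    have : supp μ ∩ C = y '' Set.Icc a b := by
      rw [← hr]
      ext x
      constructor
      · rintro ⟨⟨k, rfl⟩, hk⟩
        exact ⟨k, (hab k).1 hk, rfl⟩
      · rintro ⟨k, hk, rfl⟩
        exact ⟨⟨k, rfl⟩, (hab k).2 hk⟩
    rw [h.isSimpleCounting.apply hC, this, hy.injective.encard_image, ← Finset.coe_Icc,
      Set.encard_coe_eq_coe_finsetCard, Int.card_Icc]
    simp
  have hlt : ∀ k, y k ≤ q ↔ k ≤ n := fun k =>
    ⟨fun hk => Int.lt_add_one_iff.1 (hy.lt_iff_lt.1 (hk.trans_lt hn')),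
      fun hk => (hy.monotone hk).trans hn⟩
  have hneg : ∀ k, y k < 0 ↔ k ≤ 0 := fun k =>
    ⟨fun hk => Int.lt_add_one_iff.1 (hy.lt_iff_lt.1 (by simpa using hk.trans_le h1)),
      fun hk => (hy.monotone hk).trans_lt h0⟩
  -- Here `n` is the index of the last point at or before `q`; the normalization `y 0 < 0 ≤ y 1`
  -- makes the signed count agree with it on both sides of the origin.
  have hcum : cumul μ q = n := by
    rcases le_or_gt 0 q with hq | hq
    · have hn0 : 0 ≤ n := (hlt 0).1 (h0.le.trans hq)
      rw [cumul, Set.Ioo_eq_empty (not_lt.2 hq), hcard 1 n measurableSet_Icc fun k => ?_]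
      · simp only [measure_empty, ENNReal.toReal_zero, sub_zero]
        have : (((n + 1 - 1).toNat : ℤ) : ℝ) = (n : ℝ) := by
          rw [Int.toNat_of_nonneg (by omega)]; simp
        exact_mod_cast this
      · rw [Set.mem_Icc, hlt, ← not_lt, hneg, Set.mem_Icc]
        omega
    · have hn0 : n ≤ 0 := by
        by_contra hcon
        exact absurd ((hneg n).1 (hn.trans_lt hq)) hcon
      rw [cumul, Set.Icc_eq_empty (not_le.2 hq), hcard (n + 1) 0 measurableSet_Ioo fun k => ?_]
      · simp only [measure_empty, ENNReal.toReal_zero, zero_sub]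
        have : (((0 + 1 - (n + 1)).toNat : ℤ) : ℝ) = -(n : ℝ) := by
          rw [Int.toNat_of_nonneg (by omega)]; simp
        rw [← Int.cast_natCast, this, neg_neg]
      · rw [Set.mem_Ioo, ← not_le, hlt, hneg, Set.mem_Icc]
        omega
  rw [hcum, hlt]
  exact Int.cast_le

theorem IsBiinfinite.point_eq {μ : Measure ℝ} (h : IsBiinfinite μ) {y : ℤ → ℝ}
    (hy : StrictMono y) (hr : Set.range y = supp μ) (h0 : y 0 < 0) (h1 : 0 ≤ y 1) :
    point μ = y := by
  funext k
  have : (⨅ q : ℚ, if (k : ℝ) ≤ cumul μ q then ((q : ℝ) : EReal) else ⊤) = (y k : EReal) := by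
    refine le_antisymm (le_of_forall_gt fun c hc => ?_) (le_iInf fun q => ?_)
    · obtain ⟨d, hd1, hd2⟩ := EReal.lt_iff_exists_rat_btwn.1 hc
      refine (iInf_le _ d).trans_lt ?_
      rw [if_pos ((h.le_cumul_iff hy hr h0 h1 k d).2 (by exact_mod_cast hd1.le))]
      exact hd2
    · split_ifs with hq
      · exact EReal.coe_le_coe_iff.2 ((h.le_cumul_iff hy hr h0 h1 k q).1 hq)
      · exact le_top
  rw [point, this, EReal.toReal_coe]

theorem IsBiinfinite.strictMono_point {μ : Measure ℝ} (h : IsBiinfinite μ) :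
    StrictMono (point μ) ∧ Set.range (point μ) = supp μ := by
  obtain ⟨y, hy, hr⟩ := h.exists_strictMono
  obtain ⟨x, hx, hx0⟩ := h.exists_lt 0
  obtain ⟨i, hi⟩ : x ∈ Set.range y := hr ▸ hx
  obtain ⟨x', hx', hx0'⟩ := h.exists_gt 0
  obtain ⟨j, hj⟩ : x' ∈ Set.range y := hr ▸ hx'
  obtain ⟨n, hn, hmax⟩ := Int.exists_greatest_of_bdd (P := fun n => y n < 0)
    ⟨j, fun z hz => (hy.lt_iff_lt.1 (hz.trans (by rwa [hj]))).le⟩ ⟨i, by rwa [hi]⟩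
  have hy' : StrictMono fun k => y (k + n) := fun a b hab => hy (by omega)
  have hr' : Set.range (fun k => y (k + n)) = supp μ := by
    rw [← hr]
    exact (Equiv.addRight n).surjective.range_comp y
  rw [h.point_eq hy' hr' (by simpa using hn) (le_of_not_gt fun hlt => by
    have := hmax _ hlt
    omega)]
  exact ⟨hy', hr'⟩

/-! ### The two matchings of adjacent points -/

/-- The matching of `y (2 * j + c)` to `y (2 * j + c + 1)`, for all `j`. -/
noncomputable def alternate (y : ℤ → ℝ) (c : ℤ) : Measure (Sym2 ℝ) :=
  Measure.sum fun j : ℤ => Measure.dirac s(y (2 * j + c), y (2 * j + c + 1))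

/-- The pairs of the matching `alternate y c`. -/
def alternatePairs (y : ℤ → ℝ) (c : ℤ) : Set (Sym2 ℝ) :=
  Set.range fun j : ℤ => s(y (2 * j + c), y (2 * j + c + 1))

theorem alternate_shift (y : ℤ → ℝ) (m c : ℤ) :
    alternate (fun k => y (k + m)) c = alternate y (c + m) := by
  unfold alternate
  congr 1
  funext j
  rw [show 2 * j + (c + m) = 2 * j + c + m by ring,
    show 2 * j + c + m + 1 = 2 * j + c + 1 + m by ring]

theorem sum_comp_equiv {ι κ α : Type*} [MeasurableSpace α] (e : ι ≃ κ) (f : κ → Measure α) :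
    Measure.sum (fun i => f (e i)) = Measure.sum f :=
  Measure.ext fun C hC => by
    rw [Measure.sum_apply _ hC, Measure.sum_apply _ hC]
    exact e.tsum_eq fun k => f k C

theorem alternate_add_two_mul (y : ℤ → ℝ) (m c : ℤ) :
    alternate y (c + 2 * m) = alternate y c := by
  unfold alternate
  rw [← sum_comp_equiv (Equiv.addRight (-m))]
  congr 1
  funext j
  simp only [Equiv.coe_addRight]
  rw [show 2 * (j + -m) + (c + 2 * m) = 2 * j + c by ring]

/-- Reversal turns a right endpoint of a pair into a left one, which accounts for the extra `-1` in
the label. -/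
theorem alternate_neg (y : ℤ → ℝ) (c : ℤ) :
    alternate (fun k => y (-k)) c = alternate y (-c - 1) := by
  unfold alternate
  rw [← sum_comp_equiv (Equiv.neg ℤ)]
  congr 1
  funext j
  simp only [Equiv.neg_apply]
  rw [Sym2.eq_swap, show -(2 * -j + c + 1) = 2 * j + (-c - 1) by ring,
    show -(2 * -j + c) = 2 * j + (-c - 1) + 1 by ring]

theorem map_alternate {f : ℝ → ℝ} (hf : Measurable f) (y : ℤ → ℝ) (c : ℤ) :
    (alternate y c).map (Sym2.map f) = alternate (fun k => f (y k)) c := by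
  unfold alternate
  rw [Measure.map_sum (measurable_sym2_map hf).aemeasurable]
  congr 1
  funext j
  rw [Measure.map_dirac' (measurable_sym2_map hf), Sym2.map_mk]

theorem mem_alternatePairs {y : ℤ → ℝ} (hy : StrictMono y) {c k : ℤ} {z : ℝ} :
    s(y k, z) ∈ alternatePairs y c ↔
      (Even (k - c) ∧ z = y (k + 1)) ∨ (¬ Even (k - c) ∧ z = y (k - 1)) := by
  constructor
  · rintro ⟨j, hj⟩
    rcases Sym2.eq_iff.1 hj with ⟨h1, h2⟩ | ⟨h1, h2⟩
    · have := hy.injective h1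
      exact .inl ⟨⟨j, by omega⟩, by rw [← h2]; congr 1; omega⟩
    · have := hy.injective h2
      refine .inr ⟨Int.not_even_iff_odd.2 ⟨j, by omega⟩, by rw [← h1]; congr 1; omega⟩
  · rintro (⟨⟨j, hj⟩, rfl⟩ | ⟨h, rfl⟩)
    · exact ⟨j, by dsimp only; rw [show 2 * j + c = k by omega]⟩
    · obtain ⟨j, hj⟩ := Int.not_even_iff_odd.1 h
      refine ⟨j, ?_⟩
      dsimp only
      rw [Sym2.eq_swap, show 2 * j + c + 1 = k by omega, show 2 * j + c = k - 1 by omega]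

theorem isPerfectMatching_alternatePairs {y : ℤ → ℝ} (hy : StrictMono y) (c : ℤ) :
    IsPerfectMatching (Set.range y) (alternatePairs y c) := by
  refine ⟨?_, ?_⟩
  · rintro _ ⟨j, rfl⟩
    refine ⟨fun h => ?_, fun x hx => ?_⟩
    · have := hy.injective (Sym2.mk_isDiag_iff.1 h)
      omega
    · rcases Sym2.mem_iff.1 hx with rfl | rfl <;> exact ⟨_, rfl⟩
  · rintro _ ⟨k, rfl⟩
    by_cases h : Even (k - c)
    · exact ⟨y (k + 1), (mem_alternatePairs hy).2 (.inl ⟨h, rfl⟩), fun z hz => by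
        simpa [h] using (mem_alternatePairs hy).1 hz⟩
    · exact ⟨y (k - 1), (mem_alternatePairs hy).2 (.inr ⟨h, rfl⟩), fun z hz => by
        simpa [h] using (mem_alternatePairs hy).1 hz⟩

theorem injective_alternate {y : ℤ → ℝ} (hy : StrictMono y) (c : ℤ) :
    Function.Injective fun j : ℤ => s(y (2 * j + c), y (2 * j + c + 1)) := by
  intro i j hij
  rcases Sym2.eq_iff.1 hij with ⟨h1, -⟩ | ⟨h1, -⟩ <;>
  · have := hy.injective h1
    omega

theorem alternate_eq_sum {y : ℤ → ℝ} (hy : StrictMono y) (c : ℤ) :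
    alternate y c = Measure.sum fun e : alternatePairs y c => Measure.dirac (e : Sym2 ℝ) :=
  sum_comp_equiv (Equiv.ofInjective _ (injective_alternate hy c))
    fun e : alternatePairs y c => Measure.dirac (e : Sym2 ℝ)

theorem supp_alternate {y : ℤ → ℝ} (hy : StrictMono y) (c : ℤ) :
    supp (alternate y c) = alternatePairs y c := by
  rw [alternate_eq_sum hy, supp_sum_dirac]

theorem isSimpleCounting_alternate {y : ℤ → ℝ} (hy : StrictMono y)
    (hfin : ∀ a b, (Set.range y ∩ Set.Icc a b).Finite) (c : ℤ) :
    IsSimpleCounting (alternate y c) := by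
  refine ⟨⟨fun e => ?_⟩, alternatePairs y c, Set.countable_range _, alternate_eq_sum hy c⟩
  -- Pairs near `e` have both endpoints in one bounded interval, which holds finitely many points
  -- and so finitely many pairs.
  let U : Set (Sym2 ℝ) := {e' | e.inf - 1 < e'.inf ∧ e'.sup < e.sup + 1}
  have hinf : Continuous (Sym2.inf : Sym2 ℝ → ℝ) :=
    continuous_quot_lift _ (continuous_fst.inf continuous_snd)
  have hsup : Continuous (Sym2.sup : Sym2 ℝ → ℝ) :=
    continuous_quot_lift _ (continuous_fst.sup continuous_snd)
  have hU : IsOpen U := (isOpen_lt continuous_const hinf).inter (isOpen_lt hsup continuous_const)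
  have hUm : MeasurableSet U := (measurableSet_lt measurable_const measurable_sym2_inf).inter
    (measurableSet_lt measurable_sym2_sup measurable_const)
  refine ⟨U, hU.mem_nhds ⟨by linarith, by linarith⟩, ?_⟩
  rw [alternate_eq_sum hy, sum_dirac_apply _ hUm, lt_top_iff_ne_top, Ne,
    ENat.toENNReal_eq_top, Set.encard_eq_top_iff, Set.not_infinite]
  have hF := hfin (e.inf - 1) (e.sup + 1)
  refine ((hF.prod hF).image fun p : ℝ × ℝ => s(p.1, p.2)).subset ?_
  rintro _ ⟨⟨j, rfl⟩, h1, h2⟩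
  simp only [Sym2.inf_mk, Sym2.sup_mk, lt_inf_iff, sup_lt_iff] at h1 h2
  exact ⟨(_, _), ⟨⟨⟨_, rfl⟩, h1.1.le, h2.1.le⟩, ⟨_, rfl⟩, h1.2.le, h2.2.le⟩, rfl⟩

theorem alternate_zero_ne_one {y : ℤ → ℝ} (hy : StrictMono y) :
    alternate y 0 ≠ alternate y 1 := by
  intro h
  have h1 : s(y 0, y 1) ∈ supp (alternate y 0) := by
    rw [supp_alternate hy, mem_alternatePairs hy]
    exact .inl ⟨by simp, by simp⟩
  rw [h, supp_alternate hy, mem_alternatePairs hy] at h1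
  rcases h1 with ⟨h1, -⟩ | ⟨-, h1⟩
  · exact absurd h1 (by decide)
  · have := hy.injective h1
    omega

/-- Only the parity of the label matters, so a shift of labels fixes both matchings or exchanges
them. -/
theorem alternate_eq_or (y : ℤ → ℝ) (d : ℤ) :
    (∀ c, alternate y (c + d) = alternate y c) ∨
      (alternate y (0 + d) = alternate y 1 ∧ alternate y (1 + d) = alternate y 0) := by
  rcases Int.even_or_odd' d with ⟨m, rfl | rfl⟩
  · exact .inl fun c => alternate_add_two_mul y m c
  · refine .inr ⟨?_, ?_⟩
    · rw [show 0 + (2 * m + 1) = 1 + 2 * m by ring, alternate_add_two_mul]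
    · rw [show 1 + (2 * m + 1) = 0 + 2 * (m + 1) by ring, alternate_add_two_mul]

/-! ### Covariance under isometries -/

theorem supp_map (φ : ℝ ≃ᵢ ℝ) (μ : Measure ℝ) : supp (μ.map φ) = φ '' supp μ := by
  ext x
  rw [supp, Set.mem_ofPred_eq,
    Measure.map_apply φ.continuous.measurable (measurableSet_singleton x)]
  have : φ ⁻¹' {x} = {φ.symm x} := by
    ext z
    simp [φ.eq_symm_apply]
  rw [this]
  constructor
  · exact fun h => ⟨φ.symm x, h, by simp⟩
  · rintro ⟨z, hz, rfl⟩
    rw [φ.symm_apply_apply]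
    exact hz

theorem IsBiinfinite.map {μ : Measure ℝ} (h : IsBiinfinite μ) (φ : ℝ ≃ᵢ ℝ) :
    IsBiinfinite (μ.map φ) := by
  have hcont := φ.continuous
  refine ⟨h.isSimpleCounting.map_isometry φ, fun a => ?_, fun a => ?_⟩ <;>
  rw [supp_map] <;>
  rcases hcont.strictMono_of_inj φ.injective with hφ | hφ
  · obtain ⟨x, hx, hax⟩ := h.exists_gt (φ.symm a)
    exact ⟨φ x, ⟨x, hx, rfl⟩, by simpa using hφ hax⟩
  · obtain ⟨x, hx, hax⟩ := h.exists_lt (φ.symm a)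
    exact ⟨φ x, ⟨x, hx, rfl⟩, by simpa using hφ hax⟩
  · obtain ⟨x, hx, hax⟩ := h.exists_lt (φ.symm a)
    exact ⟨φ x, ⟨x, hx, rfl⟩, by simpa using hφ hax⟩
  · obtain ⟨x, hx, hax⟩ := h.exists_gt (φ.symm a)
    exact ⟨φ x, ⟨x, hx, rfl⟩, by simpa using hφ hax⟩

/-- An isometry of the line is monotone or antitone, so it translates or reflects the enumeration.
The shift `d` may depend on the configuration, as labels are counted from the origin, but it is the
same for both matchings. -/
theorem IsBiinfinite.map_alternate {μ : Measure ℝ} (h : IsBiinfinite μ) (φ : ℝ ≃ᵢ ℝ) :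
    ∃ d : ℤ, ∀ c, (alternate (point μ) c).map (Sym2.map φ) =
      alternate (point (μ.map φ)) (c + d) := by
  obtain ⟨hy, hr⟩ := h.strictMono_point
  obtain ⟨hy', hr'⟩ := (h.map φ).strictMono_point
  rw [supp_map, ← hr, ← Set.range_comp] at hr'
  simp_rw [PoissonMatching.map_alternate φ.continuous.measurable]
  rcases φ.continuous.strictMono_of_inj φ.injective with hφ | hφ
  · obtain ⟨m, hm⟩ := strictMono_range_eq hy' (hφ.comp hy) hr'
    refine ⟨m, fun c => ?_⟩
    rw [← alternate_shift]
    exact congrArg (alternate · c) (funext hm)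
  · have hmono : StrictMono fun k : ℤ => φ (point μ (-k)) := fun a b hab =>
      hφ (hy (neg_lt_neg hab))
    have hr'' : Set.range (point (μ.map φ)) = Set.range fun k : ℤ => φ (point μ (-k)) := by
      rw [hr']
      exact ((Equiv.neg ℤ).surjective.range_comp (φ ∘ point μ)).symm
    obtain ⟨m, hm⟩ := strictMono_range_eq hy' hmono hr''
    refine ⟨m - 1, fun c => ?_⟩
    let p : ℤ → ℝ := fun i => point (μ.map φ) (i + m)
    have h1 : (fun k => φ (point μ k)) = fun k => p (-k) := by
      funext k
      simp only [p]
      rw [← hm, neg_neg]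
    rw [h1, alternate_neg p, alternate_shift, ← alternate_add_two_mul _ c]
    congr 1
    ring

/-! ### The law of the distance to the neighboring points -/

/-- The points of `[0, 1)` around which the set `G` has no further points. -/
def isolated (μ : Measure ℝ) (G : ℝ → Set ℝ) : Set ℝ :=
  {x | x ∈ supp μ ∧ x ∈ Set.Ico (0 : ℝ) 1 ∧ ∀ z ∈ supp μ, z ∉ G x}

/-- This is the derivative of `-exp (-(r + t))` at `t = 0`, taken along `t = 1 / n`. -/
theorem tendsto_mul_exp_sub (r : ℝ) :
    Filter.Tendsto (fun n : ℕ => (n : ℝ) * (Real.exp (-r) - Real.exp (-(r + 1 / n))))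
      Filter.atTop (nhds (Real.exp (-r))) := by
  have hd : HasDerivAt (fun t : ℝ => -Real.exp (-(r + t))) (Real.exp (-r)) 0 := by
    have h1 : HasDerivAt (fun t : ℝ => -(r + t)) (-1) 0 := ((hasDerivAt_id _).const_add r).neg
    have h2 := h1.exp.neg
    rw [add_zero, mul_neg_one, neg_neg] at h2
    exact h2
  have h2 := hd.tendsto_slope_zero_right
  have h3 : Filter.Tendsto (fun n : ℕ => ((n : ℝ))⁻¹) Filter.atTop (nhdsWithin 0 (Set.Ioi 0)) :=
    tendsto_inv_atTop_nhdsGT_zero.comp tendsto_natCast_atTop_atTop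
  refine (h2.comp h3).congr fun n => ?_
  simp only [Function.comp, inv_inv, smul_eq_mul, zero_add, add_zero, one_div]
  ring

theorem IsSimpleCounting.eventually_separated {μ : Measure ℝ} (h : IsSimpleCounting μ) (a b r : ℝ) :
    ∀ᶠ n : ℕ in Filter.atTop, ∀ x ∈ supp μ ∩ Set.Icc a b, ∀ y ∈ supp μ ∩ Set.Icc a b,
      x + r < y → x + r + 1 / n < y := by
  have hfin := h.finite_inter_Icc a b
  refine (Filter.eventually_all_finite hfin).2 fun x _ =>
    (Filter.eventually_all_finite hfin).2 fun y _ => ?_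
  by_cases hxy : x + r < y
  · have := tendsto_one_div_atTop_nhds_zero_nat (𝕜 := ℝ)
    filter_upwards [this.eventually (gt_mem_nhds (sub_pos.2 hxy))] with n hn _
    linarith
  · exact Filter.Eventually.of_forall fun n h => absurd h hxy

/-- The `k`-th cell of the partition of `[0, 1)` into `n` intervals. -/
def cell (n k : ℕ) : Set ℝ := Set.Ico ((k : ℝ) / n) ((k + 1) / n)

theorem mem_cell_iff {n : ℕ} (hn : 0 < n) {k : ℕ} {x : ℝ} (hx : 0 ≤ x) :
    x ∈ cell n k ↔ ⌊n * x⌋₊ = k := by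
  have hn' : (0 : ℝ) < n := by exact_mod_cast hn
  rw [Nat.floor_eq_iff (by positivity), cell, Set.mem_Ico, div_le_iff₀ hn', lt_div_iff₀ hn',
    mul_comm x]

open Classical in
-- By `hsep` a cell holds at most one point, so sending a point to the index of its cell matches
-- isolated points with occupied cells whose test set `J k` is empty.
theorem IsSimpleCounting.sum_cell_eq {μ : Measure ℝ} (h : IsSimpleCounting μ) {G : ℝ → Set ℝ}
    {J : ℕ → Set ℝ} {n : ℕ} (hn : 0 < n) (hJm : ∀ k, MeasurableSet (J k))
    (hsep : ∀ x ∈ supp μ ∩ Set.Icc 0 1, ∀ y ∈ supp μ ∩ Set.Icc 0 1, x + 0 < y → x + 0 + 1 / n < y)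
    (hJ : ∀ x ∈ supp μ, ∀ k, x ∈ Set.Ico (0 : ℝ) 1 → x ∈ cell n k →
      ((∀ z ∈ supp μ, z ∉ J k) ↔ ∀ z ∈ supp μ, z ∉ G x)) :
    ∑ k ∈ Finset.range n, (if μ (cell n k) ≠ 0 ∧ μ (J k) = 0 then 1 else 0 : ℝ≥0∞) =
      ((isolated μ G).encard : ℝ≥0∞) := by
  have hn' : (0 : ℝ) < n := by exact_mod_cast hn
  have hinj : Set.InjOn (fun x : ℝ => ⌊n * x⌋₊) (isolated μ G) := by
    intro x hx y hy hxy
    have h1 := (mem_cell_iff hn hx.2.1.1).2 rfl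
    have h2 := (mem_cell_iff hn hy.2.1.1).2 hxy.symm
    have h3 : ((⌊n * x⌋₊ : ℝ) + 1) / n = ⌊n * x⌋₊ / n + 1 / n := add_div _ _ _
    obtain ⟨h1a, h1b⟩ := h1
    obtain ⟨h2a, h2b⟩ := h2
    have hx' : x ∈ supp μ ∩ Set.Icc 0 1 := ⟨hx.1, hx.2.1.1, hx.2.1.2.le⟩
    have hy' : y ∈ supp μ ∩ Set.Icc 0 1 := ⟨hy.1, hy.2.1.1, hy.2.1.2.le⟩
    rcases lt_trichotomy x y with hlt | heq | hlt
    · have := hsep x hx' y hy' (by linarith)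
      linarith
    · exact heq
    · have := hsep y hy' x hx' (by linarith)
      linarith
  have himage : (fun x : ℝ => ⌊n * x⌋₊) '' isolated μ G =
      ((Finset.range n).filter fun k => μ (cell n k) ≠ 0 ∧ μ (J k) = 0 : Finset ℕ) := by
    ext k
    simp only [Set.mem_image, Finset.coe_filter, Finset.mem_range, Set.mem_ofPred_eq]
    constructor
    · rintro ⟨x, ⟨hx, hx1, hG⟩, rfl⟩
      have hc := (mem_cell_iff hn hx1.1).2 rfl
      refine ⟨?_, fun h0 => (h.apply_eq_zero_iff measurableSet_Ico).1 h0 x hx hc,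
        (h.apply_eq_zero_iff (hJm _)).2 ((hJ x hx _ hx1 hc).2 hG)⟩
      rw [Nat.floor_lt (by have := hx1.1; positivity)]
      nlinarith [hx1.2]
    · rintro ⟨hk, h1, h2⟩
      rw [Ne, cell, h.apply_eq_zero_iff measurableSet_Ico] at h1
      push Not at h1
      obtain ⟨x, hx, hc⟩ := h1
      have hx0 : 0 ≤ x := le_trans (by positivity) hc.1
      have hx1 : x < 1 := hc.2.trans_le ((div_le_one hn').2 (by exact_mod_cast hk))
      exact ⟨x, ⟨hx, ⟨hx0, hx1⟩, (hJ x hx k ⟨hx0, hx1⟩ hc).1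
        ((h.apply_eq_zero_iff (hJm _)).1 h2)⟩, (mem_cell_iff hn hx0).1 hc⟩
  rw [← hinj.encard_image, himage, Set.encard_coe_eq_coe_finsetCard, ← Finset.sum_filter]
  simp

variable {Ω : Type*} [MeasurableSpace Ω] {P : Measure Ω} {R : Ω → Measure ℝ}

open Classical in
-- Discretization: for a fine partition the moving set `G x` may be replaced by a set `J n k`
-- attached to the cell. The expected count of good cells then needs only void probabilities, and
-- dominated convergence gives the limit.
theorem IsPoissonProcess.lintegral_isolated [IsProbabilityMeasure P] (hR : IsPoissonProcess P R 1)
    {r : ℝ} (hr : 0 ≤ r) {G : ℝ → Set ℝ} {J : ℕ → ℕ → Set ℝ}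
    (hJm : ∀ n k, MeasurableSet (J n k)) (hJv : ∀ n k, volume (J n k) = ENNReal.ofReal r)
    (hIJ : ∀ n k, 0 < n → volume (cell n k ∪ J n k) = ENNReal.ofReal (r + 1 / n))
    (hJ : ∀ μ, IsSimpleCounting μ → ∀ᶠ n : ℕ in Filter.atTop, ∀ x ∈ supp μ, ∀ k,
      x ∈ Set.Ico (0 : ℝ) 1 → x ∈ cell n k →
      ((∀ z ∈ supp μ, z ∉ J n k) ↔ ∀ z ∈ supp μ, z ∉ G x)) :
    AEMeasurable (fun ω => ((isolated (R ω) G).encard : ℝ≥0∞)) P ∧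
      ∫⁻ ω, ((isolated (R ω) G).encard : ℝ≥0∞) ∂P = ENNReal.ofReal (Real.exp (-r)) := by
  have hcm : ∀ n k, MeasurableSet (cell n k) := fun n k => measurableSet_Ico
  let B : ℕ → ℕ → Set Ω := fun n k => {ω | R ω (cell n k) ≠ 0 ∧ R ω (J n k) = 0}
  have hz : ∀ {C : Set ℝ}, MeasurableSet C → MeasurableSet {ω | R ω C = 0} := fun hC =>
    hR.measurable_apply hC (measurableSet_singleton 0)
  have hB : ∀ n k, MeasurableSet (B n k) := fun n k => (hz (hcm n k)).compl.inter (hz (hJm n k))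
  let D : ℕ → Ω → ℝ≥0∞ := fun n ω => ∑ k ∈ Finset.range n, if ω ∈ B n k then 1 else 0
  have hBi : ∀ n k, Measurable fun ω => if ω ∈ B n k then (1 : ℝ≥0∞) else 0 := fun n k =>
    Measurable.ite (hB n k) measurable_const measurable_const
  have hD : ∀ n, Measurable (D n) := fun n => Finset.measurable_sum _ fun k _ => hBi n k
  have hPB : ∀ n k, 0 < n →
      P (B n k) = ENNReal.ofReal (Real.exp (-r) - Real.exp (-(r + 1 / n))) := by
    intro n k hn
    have hr' : (0 : ℝ) ≤ r + 1 / n := by positivity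
    -- An occupied cell with empty test set is a difference of two nested void events.
    have h1 : B n k = {ω | R ω (J n k) = 0} \ {ω | R ω (cell n k ∪ J n k) = 0} := by
      ext ω
      simp only [B, Set.mem_ofPred_eq, Set.mem_sdiff, measure_union_null_iff]
      tauto
    have hU := (hcm n k).union (hJm n k)
    have hsub : {ω | R ω (cell n k ∪ J n k) = 0} ⊆ {ω | R ω (J n k) = 0} :=
      fun ω hω => measure_mono_null Set.subset_union_right hω
    rw [h1, measure_sdiff hsub
      (hz hU).nullMeasurableSet (measure_ne_top _ _),
      hR.prob_eq_zero (hJm n k) (by simp [hJv]), hR.prob_eq_zero hU (by simp [hIJ n k hn]),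
      hJv, hIJ n k hn, ENNReal.toReal_ofReal hr, ENNReal.toReal_ofReal hr',
      ENNReal.ofReal_sub _ (Real.exp_nonneg _)]
    simp
  have hint : ∀ n, 0 < n → ∫⁻ ω, D n ω ∂P =
      ENNReal.ofReal ((n : ℝ) * (Real.exp (-r) - Real.exp (-(r + 1 / n)))) := by
    intro n hn
    have h0 := lintegral_finsetSum (μ := P) (Finset.range n) fun k _ => hBi n k
    rw [show ∫⁻ ω, D n ω ∂P = _ from h0]
    have h1 : ∀ k, ∫⁻ ω, (if ω ∈ B n k then 1 else 0 : ℝ≥0∞) ∂P =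
        ENNReal.ofReal (Real.exp (-r) - Real.exp (-(r + 1 / n))) := fun k => by
      rw [← hPB n k hn, ← lintegral_indicator_one (hB n k)]
      exact lintegral_congr fun ω => by simp [Set.indicator_apply]
    simp_rw [h1]
    rw [Finset.sum_const, Finset.card_range, nsmul_eq_mul, ENNReal.ofReal_mul (by positivity)]
    simp
  have htend : ∀ᵐ ω ∂P, Filter.Tendsto (fun n => D n ω) Filter.atTop
      (nhds ((isolated (R ω) G).encard : ℝ≥0∞)) := by
    filter_upwards [hR.isSimplePointProcess.simple] with ω hω
    refine Filter.Tendsto.congr' ?_ tendsto_const_nhds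
    filter_upwards [hJ _ hω, hω.eventually_separated 0 1 0, Filter.eventually_gt_atTop 0]
      with n h1 h2 hn
    exact (hω.sum_cell_eq hn (hJm n) h2 h1).symm
  refine ⟨aemeasurable_of_tendsto_metrizable_ae Filter.atTop (fun n => (hD n).aemeasurable) htend,
    ?_⟩
  have hlim := tendsto_lintegral_of_dominated_convergence (μ := P)
    (f := fun ω => ((isolated (R ω) G).encard : ℝ≥0∞)) (F := D)
    (fun ω => R ω (Set.Ico 0 1)) hD ?_ ?_ htend
  · refine tendsto_nhds_unique hlim ?_
    refine ((ENNReal.continuous_ofReal.tendsto _).comp (tendsto_mul_exp_sub r)).congr' ?_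
    filter_upwards [Filter.eventually_gt_atTop 0] with n hn
    exact (hint n hn).symm
  · intro n
    filter_upwards [hR.isSimplePointProcess.simple] with ω hω
    rcases Nat.eq_zero_or_pos n with rfl | hn
    · simp [D]
    have hn' : (0 : ℝ) < n := by exact_mod_cast hn
    calc D n ω ≤ ∑ k ∈ Finset.range n, R ω (cell n k) := by
          refine Finset.sum_le_sum fun k _ => ?_
          split_ifs with hk
          · have h1 := hk.1
            rw [hω.apply (hcm n k)] at h1 ⊢
            have : (1 : ℕ∞) ≤ (supp (R ω) ∩ cell n k).encard :=
              Order.one_le_iff_ne_zero.2 fun h0 => h1 (by rw [h0]; simp)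
            exact_mod_cast this
          · exact bot_le
      _ = R ω (⋃ k ∈ Finset.range n, cell n k) := by
          refine (measure_biUnion_finset (fun i _ j _ hij => ?_) fun k _ => hcm n k).symm
          refine Set.disjoint_left.2 fun x hx hx' => hij ?_
          have hx0 : 0 ≤ x := le_trans (by positivity) hx.1
          rw [← (mem_cell_iff hn hx0).1 hx, ← (mem_cell_iff hn hx0).1 hx']
      _ ≤ R ω (Set.Ico 0 1) := by
          refine measure_mono (Set.iUnion₂_subset fun k hk x hx => ⟨?_, ?_⟩)
          · exact le_trans (by positivity) hx.1
          · exact hx.2.trans_le ((div_le_one hn').2 (by exact_mod_cast Finset.mem_range.1 hk))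
  · rw [hR.lintegral_apply measurableSet_Ico (by simp)]
    simp

theorem IsPoissonProcess.lintegral_isolated_right [IsProbabilityMeasure P]
    (hR : IsPoissonProcess P R 1) {r : ℝ} (hr : 0 ≤ r) :
    AEMeasurable (fun ω => ((isolated (R ω) fun x => Set.Ioc x (x + r)).encard : ℝ≥0∞)) P ∧
      ∫⁻ ω, ((isolated (R ω) fun x => Set.Ioc x (x + r)).encard : ℝ≥0∞) ∂P =
        ENNReal.ofReal (Real.exp (-r)) := by
  refine hR.lintegral_isolated hr (J := fun n k => Set.Ico ((k + 1 : ℝ) / n) ((k + 1) / n + r))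
    (fun n k => measurableSet_Ico) (fun n k => by simp) (fun n k hn => ?_) fun μ hμ => ?_
  · have : (0 : ℝ) < 1 / n := by positivity
    have h3 : ((k : ℝ) + 1) / n = k / n + 1 / n := add_div _ _ _
    rw [cell, Set.Ico_union_Ico_eq_Ico (by linarith) (by linarith), Real.volume_Ico]
    congr 1
    linarith
  -- Separation at distance `0` puts any later point beyond the cell of `x`; separation at distance
  -- `r` excludes points between `x + r` and the right end of `J`.
  · filter_upwards [hμ.eventually_separated 0 (r + 2) 0, hμ.eventually_separated 0 (r + 2) r,
      Filter.eventually_gt_atTop 0] with n h1 h2 hn x hx k hx1 hc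
    have hn1 : (1 : ℝ) / n ≤ 1 := by
      rw [div_le_one (by positivity)]; exact_mod_cast hn
    have h3 : ((k : ℝ) + 1) / n = k / n + 1 / n := add_div _ _ _
    have hk1 := hc.1
    have hk2 := hc.2
    have hx' : x ∈ supp μ ∩ Set.Icc 0 (r + 2) := ⟨hx, hx1.1, by linarith [hx1.2]⟩
    refine ⟨fun h z hz hzG => h z hz ?_, fun h z hz hzJ => h z hz ?_⟩
    · have := h1 x hx' z ⟨hz, by linarith [hzG.1, hx1.1], by linarith [hzG.2, hx1.2]⟩
        (by linarith [hzG.1])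
      exact ⟨by linarith, by linarith [hzG.2]⟩
    · obtain ⟨ha, hb⟩ := hzJ
      refine ⟨by linarith, le_of_not_gt fun hlt => ?_⟩
      have := h2 x hx' z ⟨hz, by linarith [hx1.1], by linarith [hx1.2]⟩ hlt
      linarith

theorem IsPoissonProcess.lintegral_isolated_left [IsProbabilityMeasure P]
    (hR : IsPoissonProcess P R 1) {r : ℝ} (hr : 0 ≤ r) :
    AEMeasurable (fun ω => ((isolated (R ω) fun x => Set.Ico (x - r) x).encard : ℝ≥0∞)) P ∧
      ∫⁻ ω, ((isolated (R ω) fun x => Set.Ico (x - r) x).encard : ℝ≥0∞) ∂P =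
        ENNReal.ofReal (Real.exp (-r)) := by
  refine hR.lintegral_isolated hr (J := fun n k => Set.Ico ((k : ℝ) / n - r) (k / n))
    (fun n k => measurableSet_Ico) (fun n k => by simp) (fun n k hn => ?_) fun μ hμ => ?_
  · have : (0 : ℝ) < 1 / n := by positivity
    have h3 : ((k : ℝ) + 1) / n = k / n + 1 / n := add_div _ _ _
    rw [cell, Set.union_comm, Set.Ico_union_Ico_eq_Ico (by linarith) (by linarith),
      Real.volume_Ico]
    congr 1
    linarith
  · filter_upwards [hμ.eventually_separated (-r - 2) 1 0, hμ.eventually_separated (-r - 2) 1 r,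
      Filter.eventually_gt_atTop 0] with n h1 h2 hn x hx k hx1 hc
    have hn1 : (1 : ℝ) / n ≤ 1 := by
      rw [div_le_one (by positivity)]; exact_mod_cast hn
    have h3 : ((k : ℝ) + 1) / n = k / n + 1 / n := add_div _ _ _
    have hk1 := hc.1
    have hk2 := hc.2
    have hx' : x ∈ supp μ ∩ Set.Icc (-r - 2) 1 := ⟨hx, by linarith [hx1.1], hx1.2.le⟩
    refine ⟨fun h z hz hzG => h z hz ?_, fun h z hz hzJ => h z hz ?_⟩
    · have := h1 z ⟨hz, by linarith [hzG.1, hx1.1], by linarith [hzG.2, hx1.2]⟩ x hx'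
        (by linarith [hzG.2])
      exact ⟨by linarith [hzG.1], by linarith⟩
    · obtain ⟨ha, hb⟩ := hzJ
      refine ⟨le_of_not_gt fun hlt => ?_, by linarith⟩
      have := h2 z ⟨hz, by linarith [hx1.1], by linarith [hx1.2]⟩ x hx' (by linarith)
      linarith

/-- A half-line contains intervals of every length `m`, so it is void with probability at most `exp
(-m)` for all `m`. -/
theorem IsPoissonProcess.ae_isBiinfinite [IsProbabilityMeasure P] (hR : IsPoissonProcess P R 1) :
    ∀ᵐ ω ∂P, IsBiinfinite (R ω) := by
  have hlim : Filter.Tendsto (fun m : ℕ => ENNReal.ofReal (Real.exp (-m)))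
      Filter.atTop (nhds 0) := by
    have : Filter.Tendsto (fun m : ℕ => Real.exp (-(m : ℝ))) Filter.atTop (nhds 0) :=
      Real.tendsto_exp_neg_atTop_nhds_zero.comp tendsto_natCast_atTop_atTop
    have h := (ENNReal.continuous_ofReal.tendsto 0).comp this
    rw [ENNReal.ofReal_zero] at h
    exact h
  have hzero : ∀ C : Set ℝ, (∀ m : ℕ, ∃ a : ℝ, Set.Ioo a (a + m) ⊆ C) →
      ∀ᵐ ω ∂P, R ω C ≠ 0 := by
    intro C hC
    rw [ae_iff]
    simp only [not_not]
    refine le_antisymm (ge_of_tendsto' hlim fun m => ?_) bot_le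
    obtain ⟨a, ha⟩ := hC m
    calc P {ω | R ω C = 0} ≤ P {ω | R ω (Set.Ioo a (a + m)) = 0} :=
          measure_mono fun ω hω => measure_mono_null ha hω
      _ = ENNReal.ofReal (Real.exp (-m)) := by
          rw [hR.prob_eq_zero measurableSet_Ioo (by simp)]
          simp
  have h1 : ∀ᵐ ω ∂P, ∀ n : ℕ, R ω (Set.Ioi (n : ℝ)) ≠ 0 := ae_all_iff.2 fun n =>
    hzero _ fun m => ⟨n, fun x hx => hx.1⟩
  have h2 : ∀ᵐ ω ∂P, ∀ n : ℕ, R ω (Set.Iio (-n : ℝ)) ≠ 0 := ae_all_iff.2 fun n =>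
    hzero _ fun m => ⟨-n - m, fun x hx => by simpa using hx.2⟩
  filter_upwards [h1, h2, hR.isSimplePointProcess.simple] with ω h1 h2 h3
  refine ⟨h3, fun a => ?_, fun a => ?_⟩
  · obtain ⟨n, hn⟩ := exists_nat_ge a
    have := h1 n
    rw [Ne, h3.apply_eq_zero_iff measurableSet_Ioi] at this
    push Not at this
    obtain ⟨x, hx, hx'⟩ := this
    exact ⟨x, hx, hn.trans_lt hx'⟩
  · obtain ⟨n, hn⟩ := exists_nat_ge (-a)
    have := h2 n
    rw [Ne, h3.apply_eq_zero_iff measurableSet_Iio] at this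
    push Not at this
    obtain ⟨x, hx, hx'⟩ := this
    have hx' : x < -n := hx'
    exact ⟨x, hx, by linarith⟩

/-! ### The product of a probability space with a fair coin -/

/-- The product of `P` and the law of a fair coin. -/
noncomputable def coin {Ω : Type*} [MeasurableSpace Ω] (P : Measure Ω) : Measure (Ω × Bool) :=
  (2⁻¹ : ℝ≥0∞) • (P.map (fun ω => (ω, false)) + P.map fun ω => (ω, true))

section Coin

variable {Ω : Type*} [MeasurableSpace Ω] {P : Measure Ω} {R : Ω → Measure ℝ}

theorem measurableEmbedding_coin (b : Bool) : MeasurableEmbedding fun ω : Ω => (ω, b) :=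
  measurableEmbedding_prod_mk_right b

/-- No measurability of `f` is needed, because the two sections are measurable embeddings. -/
theorem lintegral_coin (f : Ω × Bool → ℝ≥0∞) : ∫⁻ p, f p ∂(coin P) =
    2⁻¹ * (∫⁻ ω, f (ω, false) ∂P + ∫⁻ ω, f (ω, true) ∂P) := by
  rw [coin, lintegral_smul_measure, lintegral_add_measure,
    (measurableEmbedding_coin false).lintegral_map, (measurableEmbedding_coin true).lintegral_map,
    smul_eq_mul]

theorem ae_coin {p : Ω × Bool → Prop} :
    (∀ᵐ x ∂(coin P), p x) ↔ (∀ᵐ ω ∂P, p (ω, false)) ∧ ∀ᵐ ω ∂P, p (ω, true) := by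
  rw [coin, Measure.ae_ennreal_smul_measure_iff (by simp), ae_add_measure_iff,
    (measurableEmbedding_coin false).ae_map_iff, (measurableEmbedding_coin true).ae_map_iff]

theorem measurePreserving_fst_coin : MeasurePreserving Prod.fst (coin P) P := by
  refine ⟨measurable_fst, Measure.ext fun C hC => ?_⟩
  rw [Measure.map_apply measurable_fst hC, ← lintegral_indicator_one (measurable_fst hC),
    lintegral_coin]
  have : ∀ b : Bool, ∫⁻ ω, (Prod.fst ⁻¹' C : Set (Ω × Bool)).indicator 1 (ω, b) ∂P = P C :=
    fun b => by
      rw [← lintegral_indicator_one hC]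
      rfl
  rw [this, this, ← two_mul, ← mul_assoc, ENNReal.inv_mul_cancel (by simp) (by simp), one_mul]

/-- The matching of adjacent points that is chosen by a coin. -/
noncomputable def coinMatching (R : Ω → Measure ℝ) (p : Ω × Bool) : Measure (Sym2 ℝ) :=
  alternate (point (R p.1)) (bif p.2 then 1 else 0)

theorem measurable_alternate_point (c : ℤ) : Measurable fun μ => alternate (point μ) c := by
  refine Measure.measurable_of_measurable_coe _ fun C hC => ?_
  simp_rw [alternate, Measure.sum_apply _ hC]
  refine Measurable.tsum fun j => ?_
  exact (Measure.measurable_coe hC).comp (Measure.measurable_dirac.comp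
    (measurable_sym2_mk.comp ((measurable_point _).prodMk (measurable_point _))))

theorem measurable_coinMatching (hR : Measurable R) : Measurable (coinMatching R) :=
  measurable_from_prod_countable_left fun b =>
    (measurable_alternate_point (bif b then 1 else 0)).comp hR

variable [IsProbabilityMeasure P]

theorem IsBiinfinite.isPerfectMatching_alternate {μ : Measure ℝ} (h : IsBiinfinite μ) (c : ℤ) :
    IsPerfectMatching (supp μ) (supp (alternate (point μ) c)) := by
  obtain ⟨hy, hr⟩ := h.strictMono_point
  rw [supp_alternate hy, ← hr]
  exact isPerfectMatching_alternatePairs hy c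

theorem IsBiinfinite.isSimpleCounting_alternate {μ : Measure ℝ} (h : IsBiinfinite μ) (c : ℤ) :
    IsSimpleCounting (alternate (point μ) c) := by
  obtain ⟨hy, hr⟩ := h.strictMono_point
  refine PoissonMatching.isSimpleCounting_alternate hy (fun a b => ?_) c
  rw [hr]
  exact h.isSimpleCounting.finite_inter_Icc a b

theorem isMatchingScheme_coinMatching (hR : IsPoissonProcess P R 1) :
    IsMatchingScheme (coin P) (R ∘ Prod.fst) (coinMatching R) where
  isSimplePointProcess := ⟨measurable_coinMatching hR.measurable, ae_coin.2
    ⟨hR.ae_isBiinfinite.mono fun _ h => h.isSimpleCounting_alternate _,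
      hR.ae_isBiinfinite.mono fun _ h => h.isSimpleCounting_alternate _⟩⟩
  isPerfectMatching := ae_coin.2
    ⟨hR.ae_isBiinfinite.mono fun _ h => h.isPerfectMatching_alternate _,
      hR.ae_isBiinfinite.mono fun _ h => h.isPerfectMatching_alternate _⟩

theorem isIsometryInvariant_coinMatching (hR : IsPoissonProcess P R 1) :
    IsIsometryInvariant (coin P) (R ∘ Prod.fst) (coinMatching R) := by
  intro φ
  have hRm := hR.measurable
  have hMm := measurable_coinMatching hRm
  have hφ : Measurable φ := φ.continuous.measurable
  have hφR : Measurable fun μ : Measure ℝ => μ.map φ := Measure.measurable_map _ hφ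
  have hφM : Measurable fun m : Measure (Sym2 ℝ) => m.map (Sym2.map φ) :=
    Measure.measurable_map _ (measurable_sym2_map hφ)
  have h1 : Measurable fun p : Ω × Bool => ((R p.1).map φ, (coinMatching R p).map (Sym2.map φ)) :=
    (hφR.comp (hRm.comp measurable_fst)).prodMk (hφM.comp hMm)
  have h2 : Measurable fun p : Ω × Bool => (R p.1, coinMatching R p) :=
    (hRm.comp measurable_fst).prodMk hMm
  refine Measure.ext fun C hC => ?_
  let g : Measure ℝ × Measure (Sym2 ℝ) → ℝ≥0∞ := C.indicator 1
  have hg : Measurable g := measurable_one.indicator hC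
  have hgm : ∀ c, Measurable fun μ => g (μ, alternate (point μ) c) := fun c =>
    hg.comp (measurable_id.prodMk (measurable_alternate_point c))
  rw [← lintegral_indicator_one hC, ← lintegral_indicator_one hC]
  change ∫⁻ x, g x ∂((coin P).map fun p : Ω × Bool =>
      ((R p.1).map φ, (coinMatching R p).map (Sym2.map φ))) =
    ∫⁻ x, g x ∂((coin P).map fun p : Ω × Bool => (R p.1, coinMatching R p))
  rw [lintegral_map hg h1, lintegral_map hg h2, lintegral_coin, lintegral_coin]
  congr 1
  simp only [coinMatching, cond_true, cond_false]
  have hl := (hR.map_isometry φ).map_eq hR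
  have hsum : Measurable fun μ => g (μ, alternate (point μ) 0) + g (μ, alternate (point μ) 1) :=
    (hgm 0).add (hgm 1)
  have hgφ : ∀ c, Measurable fun ω => g ((R ω).map φ,
      (alternate (point (R ω)) c).map (Sym2.map φ)) := fun c =>
    hg.comp ((hφR.comp hRm).prodMk (hφM.comp ((measurable_alternate_point c).comp hRm)))
  have hgR : Measurable fun ω => g (R ω, alternate (point (R ω)) 0) := (hgm 0).comp hRm
  -- The sum over both sides of the coin is symmetric in the two matchings, so it is insensitive to
  -- the exchange that the isometry may cause; what remains is the invariance of the law of `R`.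
  rw [← lintegral_add_left (hgφ 0), ← lintegral_add_left hgR]
  calc _ = ∫⁻ ω, (g ((R ω).map φ, alternate (point ((R ω).map φ)) 0) +
        g ((R ω).map φ, alternate (point ((R ω).map φ)) 1)) ∂P := by
        refine lintegral_congr_ae ?_
        filter_upwards [hR.ae_isBiinfinite] with ω hω
        obtain ⟨d, hd⟩ := hω.map_alternate φ
        rw [hd, hd]
        rcases alternate_eq_or (point ((R ω).map φ)) d with h | ⟨h, h'⟩
        · rw [h, h]
        · rw [h, h', add_comm]
    _ = ∫⁻ μ, (g (μ, alternate (point μ) 0) + g (μ, alternate (point μ) 1))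
        ∂(P.map fun ω => (R ω).map φ) := (lintegral_map hsum (hφR.comp hRm)).symm
    _ = _ := by rw [hl, lintegral_map hsum hRm]

/-- Both outcomes of the coin occur over almost every configuration, so `f` would take two distinct
values at one configuration. -/
theorem not_isFactor_coinMatching (hR : IsPoissonProcess P R 1) :
    ¬ IsFactor (coin P) (R ∘ Prod.fst) (coinMatching R) := by
  rintro ⟨f, -, hf⟩
  obtain ⟨h0, h1⟩ := ae_coin.1 hf
  obtain ⟨ω, h0, h1, h⟩ := (h0.and (h1.and hR.ae_isBiinfinite)).exists
  exact alternate_zero_ne_one h.strictMono_point.1 (h0.trans h1.symm)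

theorem matchedAt_alternate {μ : Measure ℝ} (h : IsBiinfinite μ) (r : ℝ) (c : ℤ) :
    matchedAt (supp μ) (supp (alternate (point μ) c)) (Set.Ico 0 1) (Set.Ioi r) =
      {x | ∃ k, x = point μ k ∧ Even (k - c) ∧ x ∈ isolated μ fun x => Set.Ioc x (x + r)} ∪
      {x | ∃ k, x = point μ k ∧ ¬ Even (k - c) ∧ x ∈ isolated μ fun x => Set.Ico (x - r) x} := by
  obtain ⟨hy, hr⟩ := h.strictMono_point
  have hright : ∀ k, (∀ z ∈ supp μ, z ∉ Set.Ioc (point μ k) (point μ k + r)) ↔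
      |point μ k - point μ (k + 1)| ∈ Set.Ioi r := by
    intro k
    have hlt : point μ k < point μ (k + 1) := hy (by omega)
    rw [Set.mem_Ioi, abs_sub_comm, abs_of_pos (by linarith), ← hr]
    constructor
    · intro hz
      have := hz _ ⟨k + 1, rfl⟩
      by_contra hcon
      exact this ⟨hlt, by linarith⟩
    · rintro hgt _ ⟨j, rfl⟩ ⟨h1, h2⟩
      have := hy.monotone (show k + 1 ≤ j from hy.lt_iff_lt.1 h1)
      linarith
  have hleft : ∀ k, (∀ z ∈ supp μ, z ∉ Set.Ico (point μ k - r) (point μ k)) ↔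
      |point μ k - point μ (k - 1)| ∈ Set.Ioi r := by
    intro k
    have hlt : point μ (k - 1) < point μ k := hy (by omega)
    rw [Set.mem_Ioi, abs_of_pos (by linarith), ← hr]
    constructor
    · intro hz
      have := hz _ ⟨k - 1, rfl⟩
      by_contra hcon
      exact this ⟨by linarith, hlt⟩
    · rintro hgt _ ⟨j, rfl⟩ ⟨h1, h2⟩
      have := hy.monotone (show j ≤ k - 1 from Int.le_sub_one_of_lt (hy.lt_iff_lt.1 h2))
      linarith
  ext x
  rw [supp_alternate hy]
  constructor
  · rintro ⟨hx, hx1, z, hz, hzr⟩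
    obtain ⟨k, rfl⟩ : x ∈ Set.range (point μ) := hr ▸ hx
    rcases (mem_alternatePairs hy).1 hz with ⟨hk, rfl⟩ | ⟨hk, rfl⟩
    · exact .inl ⟨k, rfl, hk, hx, hx1, (hright k).2 hzr⟩
    · exact .inr ⟨k, rfl, hk, hx, hx1, (hleft k).2 hzr⟩
  · rintro (⟨k, rfl, hk, hx, hx1, hz⟩ | ⟨k, rfl, hk, hx, hx1, hz⟩)
    · exact ⟨hx, hx1, _, (mem_alternatePairs hy).2 (.inl ⟨hk, rfl⟩), (hright k).1 hz⟩
    · exact ⟨hx, hx1, _, (mem_alternatePairs hy).2 (.inr ⟨hk, rfl⟩), (hleft k).1 hz⟩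

/-- Each point is matched to its right neighbor in one of the two matchings and to its left neighbor
in the other; splitting by the parity of the index and regrouping gives the identity. -/
theorem encard_matchedAt_add {μ : Measure ℝ} (h : IsBiinfinite μ) (r : ℝ) :
    (matchedAt (supp μ) (supp (alternate (point μ) 0)) (Set.Ico 0 1) (Set.Ioi r)).encard +
      (matchedAt (supp μ) (supp (alternate (point μ) 1)) (Set.Ico 0 1) (Set.Ioi r)).encard =
    (isolated μ fun x => Set.Ioc x (x + r)).encard +
      (isolated μ fun x => Set.Ico (x - r) x).encard := by
  obtain ⟨hy, hr⟩ := h.strictMono_point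
  set A := isolated μ fun x => Set.Ioc x (x + r) with hA
  set B := isolated μ fun x => Set.Ico (x - r) x with hB
  let K : Set ℝ := {x | ∃ k, x = point μ k ∧ Even k}
  have hK : ∀ k, point μ k ∈ K ↔ Even k := fun k =>
    ⟨fun ⟨j, hj, he⟩ => hy.injective hj ▸ he, fun he => ⟨k, rfl, he⟩⟩
  have hset : ∀ (D : Set ℝ), D ⊆ supp μ → ∀ p : ℤ → Prop, ∀ L : Set ℝ,
      (∀ k, p k ↔ point μ k ∈ L) → {x | ∃ k, x = point μ k ∧ p k ∧ x ∈ D} = D ∩ L := by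
    intro D hD p L hp
    ext x
    constructor
    · rintro ⟨k, rfl, hk, hx⟩
      exact ⟨hx, (hp k).1 hk⟩
    · rintro ⟨hx, hL⟩
      obtain ⟨k, rfl⟩ : x ∈ Set.range (point μ) := hr ▸ hD hx
      exact ⟨k, rfl, (hp k).2 hL, hx⟩
  have hAs : A ⊆ supp μ := fun x hx => hx.1
  have hBs : B ⊆ supp μ := fun x hx => hx.1
  have hpar : ∀ k : ℤ, Even (k - 1) ↔ ¬ Even k := fun k => by
    rw [Int.even_sub]; simp
  rw [matchedAt_alternate h, matchedAt_alternate h,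
    hset A hAs (fun k => Even (k - 0)) K (fun k => by simp [hK]),
    hset B hBs (fun k => ¬ Even (k - 0)) Kᶜ (fun k => by simp [hK]),
    hset A hAs (fun k => Even (k - 1)) Kᶜ (fun k => by rw [hpar, Set.mem_compl_iff, hK]),
    hset B hBs (fun k => ¬ Even (k - 1)) K (fun k => by rw [hpar, not_not, hK]),
    Set.encard_union_eq (Set.disjoint_left.2 fun x hx hx' => hx'.2 hx.2),
    Set.encard_union_eq (Set.disjoint_left.2 fun x hx hx' => hx.2 hx'.2),
    ← Set.encard_sdiff_add_encard_inter A K, ← Set.encard_sdiff_add_encard_inter B K,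
    Set.sdiff_eq, Set.sdiff_eq]
  ring

theorem law_coinMatching (hR : IsPoissonProcess P R 1) {r : ℝ} (hr : 0 ≤ r) :
    ∫⁻ p, ((matchedAt (supp (R p.1)) (supp (coinMatching R p)) (Set.Ico 0 1)
      (Set.Ioi r)).encard : ℝ≥0∞) ∂(coin P) = ENNReal.ofReal (Real.exp (-r)) := by
  -- Needed to add the two lower integrals; it follows from writing the count as an integral over
  -- the pairs.
  have hm : ∀ c, AEMeasurable (fun ω => ((matchedAt (supp (R ω))
      (supp (alternate (point (R ω)) c)) (Set.Ico 0 1) (Set.Ioi r)).encard : ℝ≥0∞)) P := fun c => by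
    refine ⟨fun ω => ∫⁻ e, endpoints (Set.Ico 0 1) (Set.Ioi r) e ∂(alternate (point (R ω)) c),
      ((Measure.measurable_lintegral (measurable_endpoints measurableSet_Ico
        measurableSet_Ioi)).comp ((measurable_alternate_point c).comp hR.measurable)), ?_⟩
    filter_upwards [hR.ae_isBiinfinite] with ω h
    exact (h.isPerfectMatching_alternate c).encard_matchedAt (h.isSimpleCounting_alternate c) _ _
  rw [lintegral_coin]
  simp only [coinMatching, cond_true, cond_false]
  rw [← lintegral_add_left' (hm 0)]
  obtain ⟨hA, hA'⟩ := hR.lintegral_isolated_right hr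
  obtain ⟨-, hB'⟩ := hR.lintegral_isolated_left hr
  calc _ = 2⁻¹ * ∫⁻ ω, (((isolated (R ω) fun x => Set.Ioc x (x + r)).encard : ℝ≥0∞) +
        ((isolated (R ω) fun x => Set.Ico (x - r) x).encard : ℝ≥0∞)) ∂P := by
        congr 1
        refine lintegral_congr_ae ?_
        filter_upwards [hR.ae_isBiinfinite] with ω h
        exact_mod_cast congrArg (fun n : ℕ∞ => (n : ℝ≥0∞)) (encard_matchedAt_add h r)
    _ = ENNReal.ofReal (Real.exp (-r)) := by
        rw [lintegral_add_left' hA, hA', hB', ← two_mul, ← mul_assoc,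
          ENNReal.inv_mul_cancel (by simp) (by simp), one_mul]

end Coin

end PoissonMatching

/-! ### The main theorem -/

theorem mainTheorem5 {Ω : Type u} [MeasurableSpace Ω] (P : Measure Ω)
    [IsProbabilityMeasure P] (R : Ω → Measure ℝ) (hR : PoissonMatching.IsPoissonProcess P R 1) :
    (∀ M : Ω → Measure (Sym2 ℝ),
      PoissonMatching.IsMatchingScheme P R M →
      PoissonMatching.IsTranslationInvariant P R M →
      PoissonMatching.IsFactor P R M →
      ∃ ν : Measure ℝ, PoissonMatching.IsTypicalDistanceLaw P R M ν ∧
        ∫⁻ x, ENNReal.ofReal x ∂ν = ∞) ∧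
    (∃ (Ω' : Type u) (_ : MeasurableSpace Ω') (P' : Measure Ω') (π : Ω' → Ω)
        (M : Ω' → Measure (Sym2 ℝ)),
      IsProbabilityMeasure P' ∧ MeasurePreserving π P' P ∧
      PoissonMatching.IsMatchingScheme P' (R ∘ π) M ∧
      PoissonMatching.IsIsometryInvariant P' (R ∘ π) M ∧
      ¬ PoissonMatching.IsFactor P' (R ∘ π) M ∧
      ∃ ν : Measure ℝ, PoissonMatching.IsTypicalDistanceLaw P' (R ∘ π) M ν ∧
        ∀ r : ℝ, 0 < r → ν (Set.Ioi r) = ENNReal.ofReal (Real.exp (-r))) := by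
  have hmean : ∫⁻ ω, R ω (Set.Ico 0 1) ∂P = 1 := by
    rw [hR.lintegral_apply measurableSet_Ico (by simp)]
    simp
  refine ⟨fun M hM hinv hfac => ?_, ?_⟩
  · obtain ⟨ν, hν, hνB⟩ := hM.exists_law hR.isSimplePointProcess hmean
    have := hν.isProbabilityMeasure
    exact ⟨ν, hν, hM.lintegral_eq_top_of_isFactor hR hinv hfac hνB⟩
  · have hπ := PoissonMatching.measurePreserving_fst_coin (P := P)
    have hM := PoissonMatching.isMatchingScheme_coinMatching hR
    have hRπ : PoissonMatching.IsSimplePointProcess (PoissonMatching.coin P) (R ∘ Prod.fst) :=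
      ⟨hR.measurable.comp measurable_fst,
        hπ.quasiMeasurePreserving.ae hR.isSimplePointProcess.simple⟩
    obtain ⟨ν, hν, hνB⟩ := hM.exists_law hRπ
      ((hπ.lintegral_comp (hR.measurable_apply measurableSet_Ico)).trans hmean)
    refine ⟨Ω × Bool, inferInstance, PoissonMatching.coin P, Prod.fst,
      PoissonMatching.coinMatching R, ?_, hπ, hM,
      PoissonMatching.isIsometryInvariant_coinMatching hR,
      PoissonMatching.not_isFactor_coinMatching hR, ν, hν, fun r hr => ?_⟩
    · exact ⟨by rw [← Set.preimage_univ (f := Prod.fst), hπ.measure_preimage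
        MeasurableSet.univ.nullMeasurableSet, measure_univ]⟩
    · rw [hνB _ measurableSet_Ioi]
      exact PoissonMatching.law_coinMatching hR hr.le
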